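/- Let $M=\Gamma\backslash\mathbb H^2$ be a hyperbolic surface of finite area, where $\mathbb H^2$ is the hyperbolic plane and $\Gamma$ is a group of isometries of $\mathbb H^2$ acting freely and properly discontinuously. Let $G^t$ be the geodesic flow on the unit cotangent bundle $S^*M$ (identified with the unit tangent bundle by the metric). For an embedded curve $H\subset M$ let $S^*_HM$ be the set of unit covectors $(s,\xi)$ of $M$ with $s\in H$, and write $\xi=\sigma\pm\sqrt{1-|\sigma|^2}\,\nu$, where $\sigma$ is the component of $\xi$ tangent to $H$ and $\nu$ is a unit conormal. Let $r_H(s,\sigma\pm\sqrt{1-|\sigma|^2}\,\nu)=(s,\sigma\mp\sqrt{1-|\sigma|^2}\,\nu)$ be the reflection through $T^*H$, and let $\mu_{L,H}=|ds\,d\sigma|$ be the Liouville measure on $S^*_HM$, that is, $\sqrt{1-|\sigma|^2}\,ds\,d\theta$ with $ds$ the arc length of $H$ and $\theta$ the angle in the fibre. Let $T(s,\xi)=\inf\{t>0: G^t(s,\xi)\in S^*_HM\}\in[0,\infty]$ be the first return time, and let $T^{(j)}(s,\xi)$ be the $j$-th return time: the sum of the first $j$ successive first return times if $j\ge 1$ ($+\infty$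 if there are fewer than $j$ returns), and minus the $|j|$-th return time for the reversed flow $t\mapsto G^{-t}$ if $j\le -1$. One says that $H$ has a positive measure of microlocal reflection symmetry if $$\mu_{L,H}\Big(\bigcup_{j\neq 0}\big\{(s,\xi)\in S^*_HM:\ T^{(j)}(s,\xi)\ \text{finite},\ r_H\,G^{T^{(j)}(s,\xi)}(s,\xi)=G^{T^{(j)}(s,\xi)}\,r_H(s,\xi)\big\}\Big)>0 .$$ Lemma. Let $p\in M$ and let $0<r<\operatorname{inj}_M(p)$, where $\operatorname{inj}_M(p)$ is the injectivity radius of $M$ at $p$ (this holds in particular if $0<r<\operatorname{inj}(M)$). Then the distance circle $C_r(p)=\{x\in M: d_M(x,p)=r\}$ does not have a positive measure of microlocal reflection symmetry. -/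

import Mathlib

open scoped MatrixGroups UpperHalfPlane ENNReal NNReal ComplexConjugate

noncomputable section

namespace HypSurface

open UpperHalfPlane MeasureTheory

/-! ### The unit tangent bundle of the hyperbolic plane

The metric identifies unit covectors with unit tangent vectors. At `z = x + iy` the hyperbolic
length of `v ∈ T_z ℍ = ℂ` is `‖v‖ / y`. -/

/-- A unit tangent vector of the hyperbolic plane. -/
@[ext]
structure UnitTangent where
  base : ℍ
  dir : ℂ
  norm_dir : ‖dir‖ = base.im

instance : MeasurableSpace UnitTangent :=
  MeasurableSpace.comap (fun v : UnitTangent => (v.base, v.dir)) inferInstance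

/-- The unit tangent vector at `z` with (Euclidean, equivalently hyperbolic) angle `θ`. -/
def UnitTangent.ofAngle (z : ℍ) (θ : ℝ) : UnitTangent where
  base := z
  dir := z.im * Complex.exp (θ * Complex.I)
  norm_dir := by
    rw [norm_mul, Complex.norm_exp_ofReal_mul_I, mul_one, Complex.norm_real,
      Real.norm_of_nonneg z.im_pos.le]

lemma UnitTangent.measurable_ofAngle : Measurable (fun q : ℍ × ℝ => ofAngle q.1 q.2) := by
  refine measurable_comap_iff.2 (Measurable.prodMk measurable_fst ?_)
  have h : Continuous (fun q : ℍ × ℝ => (q.1.im : ℂ) * Complex.exp (q.2 * Complex.I)) := by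
    have := continuous_im
    fun_prop
  exact h.measurable

/-! ### The action of isometries on unit tangent vectors

`PGL(2, ℝ)` is the full isometry group of `ℍ` (elements of negative determinant act by
`z ↦ (a z̄ + b) / (c z̄ + d)` and reverse orientation). It acts on tangent vectors through the
derivative `smulFDeriv`, see `UpperHalfPlane.hasStrictFDerivAt_smul`. -/

lemma smulFDeriv_apply (g : GL (Fin 2) ℝ) (z v : ℂ) :
    smulFDeriv g z v = σ g ((g.det.val : ℂ) / denom g z ^ 2 * v) := by
  simp [smulFDeriv, mul_comm]

lemma norm_smulFDeriv (g : GL (Fin 2) ℝ) (z : ℍ) (v : ℂ) :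
    ‖smulFDeriv g z v‖ = (g • z).im / z.im * ‖v‖ := by
  have hz := z.im_pos.ne'
  rw [smulFDeriv_apply, norm_σ, norm_mul, norm_div, norm_pow, im_smul_eq_div_normSq,
    Complex.normSq_eq_norm_sq, Complex.norm_real, Real.norm_eq_abs]
  field_simp

lemma smulFDeriv_one (z : ℍ) (v : ℂ) : smulFDeriv 1 z v = v := by
  simp [smulFDeriv_apply, σ]

lemma smulFDeriv_mul (g h : GL (Fin 2) ℝ) (z : ℍ) (v : ℂ) :
    smulFDeriv (g * h) z v = smulFDeriv g ((h • z : ℍ) : ℂ) (smulFDeriv h z v) := by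
  have h1 := hasStrictFDerivAt_smul h z
  have h2 := hasStrictFDerivAt_smul g (h • z)
  have h3 := hasStrictFDerivAt_smul (g * h) z
  have h4 : HasFDerivAt (fun w : ℂ => (((g * h) • ofComplex w : ℍ) : ℂ))
      ((smulFDeriv g ((h • z : ℍ) : ℂ)).comp (smulFDeriv h z)) z := by
    have h2' : HasFDerivAt (fun w : ℂ => ((g • ofComplex w : ℍ) : ℂ))
        (smulFDeriv g ((h • z : ℍ) : ℂ)) ((h • ofComplex (z : ℂ) : ℍ) : ℂ) := by
      simpa using h2.hasFDerivAt
    refine (h2'.comp (z : ℂ) h1.hasFDerivAt).congr_of_eventuallyEq ?_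
    exact Filter.Eventually.of_forall fun w => by simp [mul_smul]
  exact congrArg (fun L => L v) (h3.hasFDerivAt.unique h4)

instance : MulAction (GL (Fin 2) ℝ) UnitTangent where
  smul g v := ⟨g • v.base, smulFDeriv g v.base v.dir, by
    rw [norm_smulFDeriv, v.norm_dir, div_mul_cancel₀ _ v.base.im_pos.ne']⟩
  one_smul v := UnitTangent.ext (one_smul _ v.base) (smulFDeriv_one v.base v.dir)
  mul_smul g h v := UnitTangent.ext (mul_smul g h v.base) (smulFDeriv_mul g h v.base v.dir)

lemma GL_smul_base (g : GL (Fin 2) ℝ) (v : UnitTangent) : (g • v).base = g • v.base := rfl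

lemma GL_smul_dir (g : GL (Fin 2) ℝ) (v : UnitTangent) :
    (g • v).dir = smulFDeriv g v.base v.dir := rfl

lemma scalar_smul (u : ℝˣ) (v : UnitTangent) :
    Matrix.GeneralLinearGroup.scalar (Fin 2) u • v = v := by
  refine UnitTangent.ext (glScalar_smul u v.base) ?_
  have hu : (u : ℝ) ≠ 0 := u.ne_zero
  have hu' : ((u : ℝ) : ℂ) ≠ 0 := by exact_mod_cast hu
  rw [GL_smul_dir, smulFDeriv_apply]
  simp [σ, sq_pos_iff, hu']

instance : MulAction PGL(2, ℝ) UnitTangent :=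
  Matrix.ProjGenLinGroup.mulActionOfGL scalar_smul

lemma mk_smul (g : GL (Fin 2) ℝ) (v : UnitTangent) :
    Matrix.ProjGenLinGroup.mk g • v = g • v := rfl

/-! ### The geodesic flow of the hyperbolic plane -/

/-- The common denominator `cosh (t/2) y + i sinh (t/2) v` in the formula for the flow. -/
def flowDenom (t : ℝ) (v : UnitTangent) : ℂ :=
  Real.cosh (t / 2) * v.base.im + Complex.I * Real.sinh (t / 2) * v.dir

lemma flowDenom_ne_zero (t : ℝ) (v : UnitTangent) : flowDenom t v ≠ 0 := by
  intro h
  have h1 : (Real.cosh (t / 2) * v.base.im : ℂ) = -(Complex.I * Real.sinh (t / 2) * v.dir) :=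
    eq_neg_of_add_eq_zero_left h
  have h2 := congrArg norm h1
  rw [norm_neg, norm_mul, norm_mul, norm_mul, Complex.norm_I, one_mul, v.norm_dir,
    Complex.norm_real, Complex.norm_real, Complex.norm_real, Real.norm_of_nonneg v.base.im_pos.le]
    at h2
  have h3 := mul_right_cancel₀ v.base.im_pos.ne' h2
  have h4 : Real.cosh (t / 2) ^ 2 = Real.sinh (t / 2) ^ 2 := by
    rw [← sq_abs (Real.cosh _), ← sq_abs (Real.sinh _)]
    exact congrArg (· ^ 2) h3
  have := Real.cosh_sq (t / 2)
  linarith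

/-- The point at time `t` of the unit speed geodesic with initial vector `v`. -/
def flowPoint (t : ℝ) (v : UnitTangent) : ℂ :=
  (Real.cosh (t / 2) * v.base.im * v.base + Complex.I * Real.sinh (t / 2) * v.dir * conj (v.base : ℂ))
    / flowDenom t v

/-- The velocity at time `t` of the unit speed geodesic with initial vector `v`. -/
def flowVelocity (t : ℝ) (v : UnitTangent) : ℂ :=
  v.base.im ^ 2 * v.dir / flowDenom t v ^ 2

lemma flowPoint_im (t : ℝ) (v : UnitTangent) :
    (flowPoint t v).im = v.base.im ^ 3 / ‖flowDenom t v‖ ^ 2 := by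
  have hn : v.dir.re ^ 2 + v.dir.im ^ 2 = v.base.im ^ 2 := by
    rw [← v.norm_dir, ← Complex.normSq_eq_norm_sq, Complex.normSq_apply]; ring
  have hC := Real.cosh_sq (t / 2)
  have hd : Complex.normSq (flowDenom t v) ≠ 0 := by simpa using flowDenom_ne_zero t v
  rw [← Complex.normSq_eq_norm_sq, flowPoint, Complex.div_im, ← sub_div]
  congr 1
  simp only [flowDenom, Complex.add_im, Complex.mul_im, Complex.ofReal_re, Complex.ofReal_im,
    Complex.add_re, Complex.mul_re, Complex.I_re, Complex.I_im, Complex.conj_re, Complex.conj_im,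
    coe_re, coe_im]
  generalize Real.cosh (t / 2) = C at *
  generalize Real.sinh (t / 2) = S at *
  generalize v.dir.re = p at *
  generalize v.dir.im = q at *
  generalize v.base.im = y at *
  generalize v.base.re = x at *
  linear_combination (- S ^ 2 * y) * hn + y ^ 3 * hC

/-- The geodesic flow `G^t` on the unit tangent bundle of the hyperbolic plane. -/
def planeFlow (t : ℝ) (v : UnitTangent) : UnitTangent where
  base := ⟨flowPoint t v, by
    rw [flowPoint_im]
    have := norm_pos_iff.2 (flowDenom_ne_zero t v)
    have := v.base.im_pos
    positivity⟩
  dir := flowVelocity t v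
  norm_dir := by
    change _ = (flowPoint t v).im
    rw [flowPoint_im, flowVelocity, norm_div, norm_mul, norm_pow, norm_pow, v.norm_dir,
      Complex.norm_real, Real.norm_of_nonneg v.base.im_pos.le]
    ring

/-! The orbits of `planeFlow` are the unit speed geodesics: the curve starts at `v`, its derivative
is its velocity, and it solves the geodesic equation `z'' = -i (z')² / Im z` of the metric
`(dx² + dy²) / y²`. -/

lemma planeFlow_zero (v : UnitTangent) : planeFlow 0 v = v := by
  have hy : (v.base.im : ℂ) ≠ 0 := by exact_mod_cast v.base.im_pos.ne'
  refine UnitTangent.ext (UpperHalfPlane.ext ?_) ?_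
  · change flowPoint 0 v = v.base
    simp [flowPoint, flowDenom, hy]
  · change flowVelocity 0 v = v.dir
    simp [flowVelocity, flowDenom, hy]

lemma hasDerivAt_cosh_half (t : ℝ) :
    HasDerivAt (fun t : ℝ => ((Real.cosh (t / 2) : ℝ) : ℂ)) ((Real.sinh (t / 2) : ℂ) / 2) t := by
  have := ((Real.hasDerivAt_cosh (t / 2)).comp t ((hasDerivAt_id t).div_const 2)).ofReal_comp
  simpa [div_eq_mul_inv] using this

lemma hasDerivAt_sinh_half (t : ℝ) :
    HasDerivAt (fun t : ℝ => ((Real.sinh (t / 2) : ℝ) : ℂ)) ((Real.cosh (t / 2) : ℂ) / 2) t := by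
  have := ((Real.hasDerivAt_sinh (t / 2)).comp t ((hasDerivAt_id t).div_const 2)).ofReal_comp
  simpa [div_eq_mul_inv] using this

lemma hasDerivAt_flowDenom (t : ℝ) (v : UnitTangent) :
    HasDerivAt (fun t => flowDenom t v)
      ((Real.sinh (t / 2) * v.base.im + Complex.I * Real.cosh (t / 2) * v.dir) / 2) t := by
  have := ((hasDerivAt_cosh_half t).mul_const (v.base.im : ℂ)).add
    (((hasDerivAt_sinh_half t).const_mul Complex.I).mul_const v.dir)
  refine this.congr_deriv ?_
  ring

lemma planeFlow_hasDerivAt_base (t : ℝ) (v : UnitTangent) :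
    HasDerivAt (fun t => ((planeFlow t v).base : ℂ)) (planeFlow t v).dir t := by
  change HasDerivAt (fun t => flowPoint t v) (flowVelocity t v) t
  have h1 := (((hasDerivAt_cosh_half t).mul_const (v.base.im : ℂ)).mul_const (v.base : ℂ)).add
    ((((hasDerivAt_sinh_half t).const_mul Complex.I).mul_const v.dir).mul_const
      (conj (v.base : ℂ)))
  have h2 := h1.div (hasDerivAt_flowDenom t v) (flowDenom_ne_zero t v)
  refine h2.congr_deriv ?_
  have hC : (Real.cosh (t / 2) : ℂ) ^ 2 = (Real.sinh (t / 2) : ℂ) ^ 2 + 1 := by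
    exact_mod_cast Real.cosh_sq (t / 2)
  have hz : (v.base : ℂ) - conj (v.base : ℂ) = 2 * v.base.im * Complex.I := by
    rw [Complex.sub_conj]; simp
  have hI := Complex.I_sq
  rw [flowVelocity]
  congr 1
  simp only [Pi.add_apply, flowDenom]
  generalize ((Real.cosh (t / 2) : ℝ) : ℂ) = C at *
  generalize ((Real.sinh (t / 2) : ℝ) : ℂ) = S at *
  generalize conj (v.base : ℂ) = zb at *
  generalize (v.base : ℂ) = z at *
  generalize v.dir = w at *
  generalize (v.base.im : ℂ) = y at *
  linear_combination (-Complex.I * w * y / 2) * hz * (C ^ 2 - S ^ 2) +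
    y ^ 2 * w * hC - y ^ 2 * w * (C ^ 2 - S ^ 2) * hI

lemma planeFlow_hasDerivAt_dir (t : ℝ) (v : UnitTangent) :
    HasDerivAt (fun t => (planeFlow t v).dir)
      (-Complex.I * (planeFlow t v).dir ^ 2 / (planeFlow t v).base.im) t := by
  have hd := flowDenom_ne_zero t v
  have hy : (v.base.im : ℂ) ≠ 0 := by exact_mod_cast v.base.im_pos.ne'
  have him : ((planeFlow t v).base.im : ℂ) =
      v.base.im ^ 3 / (flowDenom t v * conj (flowDenom t v)) := by
    change (((flowPoint t v).im : ℝ) : ℂ) = _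
    rw [flowPoint_im, Complex.mul_conj, Complex.normSq_eq_norm_sq]
    push_cast; ring
  have hcd : conj (flowDenom t v) ≠ 0 := by simpa using hd
  have hconj : conj (flowDenom t v) = Real.cosh (t / 2) * v.base.im -
      Complex.I * Real.sinh (t / 2) * conj v.dir := by
    simp only [flowDenom, map_add, map_mul, Complex.conj_ofReal, Complex.conj_I]
    ring
  have hvv : v.dir * conj v.dir = v.base.im ^ 2 := by
    rw [Complex.mul_conj, Complex.normSq_eq_norm_sq, v.norm_dir]; push_cast; rfl
  rw [him]
  change HasDerivAt (fun t => flowVelocity t v) (-Complex.I * flowVelocity t v ^ 2 / _) t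
  have h1 := ((hasDerivAt_flowDenom t v).pow 2)
  have h2 := (hasDerivAt_const t ((v.base.im : ℂ) ^ 2 * v.dir)).div h1 (pow_ne_zero 2 hd)
  refine h2.congr_deriv ?_
  rw [flowVelocity]
  field_simp
  rw [hconj]
  have hI := Complex.I_sq
  simp only [Nat.cast_ofNat, pow_one, Nat.add_one_sub_one]
  generalize ((Real.cosh (t / 2) : ℝ) : ℂ) = C at *
  generalize ((Real.sinh (t / 2) : ℝ) : ℂ) = S at *
  generalize conj v.dir = wb at *
  generalize v.dir = w at *
  generalize (v.base.im : ℂ) = y at *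
  simp only [Pi.pow_apply]
  linear_combination (-2 * flowDenom t v ^ 4 * y * w ^ 2 * S * wb) * hI +
    (2 * flowDenom t v ^ 4 * y * w * S) * hvv

lemma planeFlow_GL_smul (g : GL (Fin 2) ℝ) (t : ℝ) (v : UnitTangent) :
    planeFlow t (g • v) = g • planeFlow t v := by
  have hD := flowDenom_ne_zero t v
  have hE : denom g v.base ≠ 0 := denom_ne_zero g v.base
  have hEb : conj (denom g v.base) ≠ 0 := by simp
  have hdet : (g.val.det : ℂ) ≠ 0 := by exact_mod_cast g.det_ne_zero
  have hDb : conj (flowDenom t v) ≠ 0 := by simpa using hD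
  -- the denominator of `g` at the point of the geodesic
  set K : ℂ := Real.cosh (t / 2) * v.base.im * denom g v.base +
    Complex.I * Real.sinh (t / 2) * v.dir * conj (denom g v.base) with hKdef
  have hcE : conj (denom g v.base) = g 1 0 * conj (v.base : ℂ) + g 1 1 := by simp [denom]
  have hcN : conj (num g v.base) = g 0 0 * conj (v.base : ℂ) + g 0 1 := by simp [num]
  have hden : denom g (flowPoint t v) = K / flowDenom t v := by
    rw [eq_div_iff hD, hKdef, hcE, denom, denom, flowPoint]
    field_simp
    simp only [flowDenom]
    ring
  have hnum : num g (flowPoint t v) = (Real.cosh (t / 2) * v.base.im * num g v.base +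
      Complex.I * Real.sinh (t / 2) * v.dir * conj (num g v.base)) / flowDenom t v := by
    rw [eq_div_iff hD, hcN, num, num, flowPoint]
    field_simp
    simp only [flowDenom]
    ring
  have hK : K ≠ 0 := by
    intro h
    have := denom_ne_zero g (planeFlow t v).base
    change denom g (flowPoint t v) ≠ 0 at this
    rw [hden, h, zero_div] at this
    exact this rfl
  have hKb : conj K ≠ 0 := by simpa using hK
  have him : ((g • v.base).im : ℂ) =
      (|g.det.val| : ℝ) * v.base.im / (denom g v.base * conj (denom g v.base)) := by
    rw [im_smul_eq_div_normSq, Complex.mul_conj]; push_cast; rfl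
  have hfd : flowDenom t (g • v) = σ g ((|g.det.val| : ℝ) /
      (denom g v.base ^ 2 * conj (denom g v.base)) * K) := by
    rw [flowDenom, GL_smul_base, GL_smul_dir, him, smulFDeriv_apply]
    rcases g.det_ne_zero.lt_or_gt with h | h
    · simp [σ, h.not_gt, abs_of_neg h, hKdef, -Complex.ofReal_cosh, -Complex.ofReal_sinh]
      field_simp
      try ring
    · simp [σ, h, abs_of_pos h, hKdef, -Complex.ofReal_cosh, -Complex.ofReal_sinh]
      field_simp
  refine UnitTangent.ext (UpperHalfPlane.ext ?_) ?_
  · change flowPoint t (g • v) = σ g (num g (flowPoint t v) / denom g (flowPoint t v))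
    rw [hden, hnum]
    rw [flowPoint, hfd, GL_smul_base, GL_smul_dir, him, smulFDeriv_apply, coe_smul]
    rcases g.det_ne_zero.lt_or_gt with h | h
    · simp [σ, h.not_gt, abs_of_neg h, -Complex.ofReal_cosh, -Complex.ofReal_sinh]
      field_simp
      try ring
    · simp [σ, h, abs_of_pos h, -Complex.ofReal_cosh, -Complex.ofReal_sinh]
      field_simp
  · change flowVelocity t (g • v) = smulFDeriv g (flowPoint t v) (flowVelocity t v)
    rw [smulFDeriv_apply, hden, flowVelocity, flowVelocity, hfd, GL_smul_base, GL_smul_dir, him, smulFDeriv_apply]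
    rcases g.det_ne_zero.lt_or_gt with h | h
    · simp [σ, h.not_gt, abs_of_neg h, -Complex.ofReal_cosh, -Complex.ofReal_sinh]
      field_simp
      try ring
    · simp [σ, h, abs_of_pos h, -Complex.ofReal_cosh, -Complex.ofReal_sinh]
      field_simp

lemma planeFlow_smul (γ : PGL(2, ℝ)) (t : ℝ) (v : UnitTangent) :
    planeFlow t (γ • v) = γ • planeFlow t v := by
  induction γ using Matrix.ProjGenLinGroup.induction_on with
  | mk g => exact planeFlow_GL_smul g t v

/-! ### Hyperbolic surfaces -/

/-- `Γ` is the deck group of a complete hyperbolic surface `Γ \ ℍ` of finite area: it acts freely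
and properly discontinuously, and some measurable set of finite hyperbolic area meets every
orbit. -/
structure IsSurfaceGroup (Γ : Subgroup PGL(2, ℝ)) : Prop where
  free : ∀ γ ∈ Γ, ∀ z : ℍ, γ • z = z → γ = 1
  properlyDiscontinuous : ProperlyDiscontinuousSMul Γ ℍ
  finite_area : ∃ F : Set ℍ, MeasurableSet F ∧ (∀ z : ℍ, ∃ γ ∈ Γ, γ • z ∈ F) ∧ volume F < ⊤

variable (Γ : Subgroup PGL(2, ℝ))

/-- The surface `M = Γ \ ℍ`. -/
abbrev Surface : Type := MulAction.orbitRel.Quotient Γ ℍ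

/-- The unit (co)tangent bundle `S^*M` of `M = Γ \ ℍ`. -/
abbrev UnitBundle : Type := MulAction.orbitRel.Quotient Γ UnitTangent

/-- The covering projection `ℍ → M`. -/
def proj (z : ℍ) : Surface Γ := Quotient.mk (MulAction.orbitRel Γ ℍ) z

/-- The covering projection onto the unit (co)tangent bundle of `M`. -/
def projUnit (v : UnitTangent) : UnitBundle Γ := Quotient.mk (MulAction.orbitRel Γ UnitTangent) v

/-- The foot point `S^*M → M`. -/
def foot : UnitBundle Γ → Surface Γ :=
  Quotient.map UnitTangent.base (by
    rintro v w ⟨γ, rfl⟩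
    refine ⟨γ, ?_⟩
    obtain ⟨γ, hγ⟩ := γ
    induction γ using Matrix.ProjGenLinGroup.induction_on with
    | mk g => rfl)

/-- The geodesic flow `G^t` on the unit (co)tangent bundle of `M`. -/
def flow (t : ℝ) : UnitBundle Γ → UnitBundle Γ :=
  Quotient.map (planeFlow t) (by
    rintro v w ⟨γ, rfl⟩
    exact ⟨γ, (planeFlow_smul γ.1 t w).symm⟩)

/-- The distance of `M`: the infimum of the distances of the lifts. -/
def surfaceDist (x y : Surface Γ) : ℝ :=
  sInf {d : ℝ | ∃ z w : ℍ, proj Γ z = x ∧ proj Γ w = y ∧ dist z w = d}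

/-- The injectivity radius of `M` at `p`: the supremum of the `ρ` such that `exp_p` is injective on
the open disc of radius `ρ` in `T_p M`. As `exp_z` maps this disc diffeomorphically onto the ball
of radius `ρ` around a lift `z` of `p`, this means that the covering projection is injective on
that ball. -/
def injectivityRadius (p : Surface Γ) : ℝ≥0∞ :=
  ⨆ (ρ : ℝ≥0) (_ : ∀ z : ℍ, proj Γ z = p → Set.InjOn (proj Γ) (Metric.ball z ρ)), (ρ : ℝ≥0∞)

/-- The distance circle of `M` with centre `p` and radius `r`. -/
def distanceCircle (p : Surface Γ) (r : ℝ) : Set (Surface Γ) :=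
  {x | surfaceDist Γ x p = r}

/-! ### Curves, reflection and Liouville measure

In the following `H ⊆ M` is an embedded curve. It is handled through its full preimage in `ℍ`, an
embedded curve that is invariant under `Γ`. -/

/-- The tangent line at `z` of a curve `K` in the hyperbolic plane. -/
def tangentLine (K : Set ℍ) (z : ℍ) : Submodule ℝ ℂ :=
  Submodule.span ℝ (tangentConeAt ℝ ((fun w : ℍ => (w : ℂ)) '' K) (z : ℂ))

/-- The reflection `σ ± √(1 - |σ|²) ν ↦ σ ∓ √(1 - |σ|²) ν` through the tangent line of `K` at the
foot point. (The hyperbolic metric is conformal, so that orthogonality is Euclidean.) -/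
def planeReflection (K : Set ℍ) (v : UnitTangent) : UnitTangent where
  base := v.base
  dir := (tangentLine K v.base).reflection v.dir
  norm_dir := by rw [LinearIsometryEquiv.norm_map, v.norm_dir]

/-- The hyperbolic length `√(1 - |σ|²)` of the component of `v` normal to `K`. -/
def normalPart (K : Set ℍ) (v : UnitTangent) : ℝ :=
  ‖v.dir - (tangentLine K v.base).starProjection v.dir‖ / v.base.im

/-- The measure `√(1 - |σ|²) ds dθ = |ds dσ|` on the unit vectors with foot point on `K`: here `ds`
is the arc length of `K`, that is its one-dimensional Hausdorff measure, and `θ` is the angle in the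
fibre. -/
def planeLiouville (K : Set ℍ) : Measure UnitTangent :=
  ((((Measure.hausdorffMeasure 1 : Measure ℍ).restrict K).prod
      ((volume : Measure ℝ).restrict (Set.Ioc (-Real.pi) Real.pi))).map
    (fun q => UnitTangent.ofAngle q.1 q.2)).withDensity
    (fun v => ENNReal.ofReal (normalPart K v))

lemma map_tangentLine_le (K : Set ℍ) (g : GL (Fin 2) ℝ) (hK : ∀ z, g • z ∈ K ↔ z ∈ K) (z : ℍ) :
    (tangentLine K z).map (smulFDeriv g z : ℂ →ₗ[ℝ] ℂ) ≤ tangentLine K (g • z) := by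
  rw [tangentLine, Submodule.map_span, Submodule.span_le]
  rintro _ ⟨u, hu, rfl⟩
  have h := ((hasStrictFDerivAt_smul g z).hasFDerivAt.hasFDerivWithinAt
    (s := (fun w : ℍ => (w : ℂ)) '' K)).mapsTo_tangent_cone hu
  refine Submodule.subset_span ?_
  simp only [ofComplex_apply] at h
  refine tangentConeAt_mono ?_ h
  rintro _ ⟨_, ⟨w, hw, rfl⟩, rfl⟩
  exact ⟨g • w, (hK w).2 hw, by simp⟩

lemma tangentLine_GL_smul (K : Set ℍ) (g : GL (Fin 2) ℝ) (hK : ∀ z, g • z ∈ K ↔ z ∈ K) (z : ℍ) :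
    tangentLine K (g • z) = (tangentLine K z).map (smulFDeriv g z : ℂ →ₗ[ℝ] ℂ) := by
  refine le_antisymm ?_ (map_tangentLine_le K g hK z)
  have h1 := map_tangentLine_le K g⁻¹ (fun w => by rw [← hK, smul_inv_smul]) (g • z)
  rw [inv_smul_smul] at h1
  intro u hu
  have h2 := h1 (Submodule.mem_map_of_mem hu)
  refine ⟨_, h2, ?_⟩
  have h3 := smulFDeriv_mul g g⁻¹ (g • z) u
  rw [mul_inv_cancel, smulFDeriv_one, inv_smul_smul] at h3
  exact h3.symm

lemma inner_smulFDeriv (g : GL (Fin 2) ℝ) (z u w : ℂ) :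
    inner ℝ (smulFDeriv g z u) (smulFDeriv g z w) =
      ‖(g.det.val : ℂ) / denom g z ^ 2‖ ^ 2 * inner ℝ u w := by
  simp only [smulFDeriv_apply]
  generalize (g.det.val : ℂ) / denom g z ^ 2 = m
  rw [← Complex.normSq_eq_norm_sq, Complex.normSq_apply]
  simp only [σ, Complex.inner]
  split_ifs <;> simp <;> ring

lemma planeReflection_GL_smul (K : Set ℍ) (g : GL (Fin 2) ℝ) (hK : ∀ z, g • z ∈ K ↔ z ∈ K)
    (v : UnitTangent) : planeReflection K (g • v) = g • planeReflection K v := by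
  refine UnitTangent.ext rfl ?_
  change (tangentLine K (g • v.base)).reflection (smulFDeriv g v.base v.dir) =
    smulFDeriv g v.base ((tangentLine K v.base).reflection v.dir)
  set T := tangentLine K v.base with hT
  have hp : T.starProjection v.dir ∈ T := T.starProjection_apply_mem v.dir
  have hq : v.dir - T.starProjection v.dir ∈ Tᗮ := T.sub_starProjection_mem_orthogonal v.dir
  generalize T.starProjection v.dir = a at hp hq
  obtain ⟨b, hb⟩ : ∃ b, b = v.dir - a := ⟨_, rfl⟩
  rw [← hb] at hq
  have hv : v.dir = a + b := by rw [hb]; ring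
  have hLa : smulFDeriv g v.base a ∈ tangentLine K (g • v.base) := by
    rw [tangentLine_GL_smul K g hK]
    exact ⟨a, hp, rfl⟩
  have hLb : smulFDeriv g v.base b ∈ (tangentLine K (g • v.base))ᗮ := by
    rw [tangentLine_GL_smul K g hK, Submodule.mem_orthogonal]
    rintro _ ⟨c, hc, rfl⟩
    have := (Submodule.mem_orthogonal _ _).1 hq c hc
    exact (inner_smulFDeriv g v.base c b).trans (by rw [this, mul_zero])
  rw [hv, map_add, map_add, map_add, map_add,
    Submodule.reflection_mem_subspace_eq_self hLa, Submodule.reflection_mem_subspace_eq_self hp,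
    Submodule.reflection_mem_subspace_orthogonalComplement_eq_neg hLb,
    Submodule.reflection_mem_subspace_orthogonalComplement_eq_neg hq, map_neg]

/-- The full preimage of a subset of `M` in the hyperbolic plane. -/
def lift (H : Set (Surface Γ)) : Set ℍ := proj Γ ⁻¹' H

lemma planeReflection_smul (H : Set (Surface Γ)) (γ : Γ) (v : UnitTangent) :
    planeReflection (lift Γ H) (γ • v) = γ • planeReflection (lift Γ H) v := by
  have hK : ∀ z : ℍ, γ.1 • z ∈ lift Γ H ↔ z ∈ lift Γ H := by
    intro z
    have : proj Γ (γ.1 • z) = proj Γ z := Quotient.sound ⟨γ, rfl⟩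
    simp only [lift, Set.mem_preimage, this]
  obtain ⟨γ, hγ⟩ := γ
  induction γ using Matrix.ProjGenLinGroup.induction_on with
  | mk g => exact planeReflection_GL_smul (lift Γ H) g hK v

/-- The reflection `r_H` of unit (co)vectors of `M` at points of `H`. -/
def reflection (H : Set (Surface Γ)) : UnitBundle Γ → UnitBundle Γ :=
  Quotient.map (planeReflection (lift Γ H)) (by
    rintro v w ⟨γ, rfl⟩
    exact ⟨γ, (planeReflection_smul Γ H γ w).symm⟩)

/-- The set `S^*_H M` of unit (co)vectors of `M` with foot point on `H`. -/
def unitBundleOver (H : Set (Surface Γ)) : Set (UnitBundle Γ) := foot Γ ⁻¹' H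

/-- The measure of a set `A` of unit (co)vectors of `M` with respect to the Liouville measure
`μ_{L,H} = |ds dσ|` on `S^*_H M`. The measure on the quotient by `Γ` of the invariant measure
upstairs is the least measure of a measurable set whose projection contains `A`; it is attained at
the part over `A` of a fundamental set. -/
def liouville (H : Set (Surface Γ)) (A : Set (UnitBundle Γ)) : ℝ≥0∞ :=
  ⨅ (F : Set UnitTangent) (_ : MeasurableSet F) (_ : A ⊆ projUnit Γ '' F),
    planeLiouville (lift Γ H) F

/-! ### Return times -/

section ReturnTimes

variable {X : Type*} (φ : ℝ → X → X) (S : Set X)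

/-- The first return time `T(x) = inf {t > 0 : φ^t x ∈ S}`, which is `∞` if there is no return. -/
def firstReturnTime (x : X) : ℝ≥0∞ :=
  ⨅ (t : ℝ) (_ : 0 < t) (_ : φ t x ∈ S), ENNReal.ofReal t

/-- The `j`-th return time, the sum of the first return times along the first `j` iterates of the
first return map (and `∞` if there are fewer than `j` returns). -/
def forwardReturnTime : ℕ → X → ℝ≥0∞
  | 0, _ => 0
  | j + 1, x =>
    forwardReturnTime j x + firstReturnTime φ S (φ (forwardReturnTime j x).toReal x)

/-- The return time `T^{(j)}` for `j ∈ ℤ`; negative indices are the returns in the past. -/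
def returnTime : ℤ → X → EReal
  | Int.ofNat j, x => (forwardReturnTime φ S j x : EReal)
  | Int.negSucc j, x => -(forwardReturnTime (fun t => φ (-t)) S (j + 1) x : EReal)

end ReturnTimes

/-! ### Microlocal reflection symmetry -/

/-- The set of all `(s, ξ) ∈ S^*_H M` with `r_H G^T (s, ξ) = G^T r_H (s, ξ)` for some finite return
time `T = T^{(j)}(s, ξ)`, `j ≠ 0`. -/
def symmetricSet (H : Set (Surface Γ)) : Set (UnitBundle Γ) :=
  {x | x ∈ unitBundleOver Γ H ∧ ∃ j : ℤ, j ≠ 0 ∧ ∃ t : ℝ,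
    returnTime (flow Γ) (unitBundleOver Γ H) j x = (t : EReal) ∧
      reflection Γ H (flow Γ t x) = flow Γ t (reflection Γ H x)}

/-- `H` has a positive measure of microlocal reflection symmetry. -/
def HasPositiveMeasureReflectionSymmetry (H : Set (Surface Γ)) : Prop :=
  0 < liouville Γ H (symmetricSet Γ H)

end HypSurface

end

noncomputable section

namespace HypSurface

open UpperHalfPlane MeasureTheory

/-! ### Distance to a point along a geodesic -/

/-! The proof replaces a symmetry of the flow by an equality between conserved quantities. Along a
unit speed geodesic, `cosh` of the distance to a point `q` solves `f'' = f` (`cosh_dist_planeFlow`),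
so `f² - f'²` is constant: this is `clairaut`. It is equivariant under isometries and unchanged when
the component of the vector along the gradient of the distance to `q` is reversed.

Since `r` is below the injectivity radius, the preimage of the circle in the plane is a union of
circles around the lifts of `p`, and these circles stay a positive distance apart. Hence reflection
on the surface lifts to radial reflection at the centre of the relevant circle. Let `v` lie over the
circle around `o`, let it return to the circle around `q`, and suppose that it is symmetric. Passing
the Clairaut quantity through the symmetry relation gives `clairaut v q = clairaut (radialReflection
o v) q'` for some lift `q'` of `p` (`symmetricSet_distanceCircle_subset`). The case `q = q' = o`,
where this equation is empty, is impossible: `v` and its reflection would both be back at distance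
`r` from `o` at the same nonzero time, with opposite radial speeds at the start.

For every other pair the equation is a trigonometric equation of degree two in the fibre angle. It
has finitely many solutions except over finitely many points of the circle (`finite_angles`,
`finite_exceptional_points`), so Fubini makes its solution set null
(`planeLiouville_clairautCoincidence`). There are only countably many pairs of lifts. -/

/-- The hyperbolic distance function is invariant under `GL(2, ℝ)`. -/
lemma dist_GL_smul (g : GL (Fin 2) ℝ) (z w : ℍ) : dist (g • z) (g • w) = dist z w := by
  have hz : denom g z ≠ 0 := denom_ne_zero g z
  have hw : denom g w ≠ 0 := denom_ne_zero g w
  have key : num g z / denom g z - num g w / denom g w =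
      g.val.det * ((z : ℂ) - w) / (denom g z * denom g w) := by
    rw [div_sub_div _ _ hz hw, Matrix.det_fin_two]
    simp only [num, denom]
    push_cast
    ring
  have h1 : dist ((g • z : ℍ) : ℂ) ((g • w : ℍ) : ℂ) =
      |g.val.det| * dist (z : ℂ) w / (‖denom g z‖ * ‖denom g w‖) := by
    rw [dist_eq_norm, coe_smul, coe_smul, ← map_sub, norm_σ, key, norm_div, norm_mul, norm_mul,
      Complex.norm_real, dist_eq_norm, Real.norm_eq_abs]
  have h3 : Real.cosh (dist (g • z) (g • w)) = Real.cosh (dist z w) := by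
    rw [cosh_dist, cosh_dist, h1, im_smul_eq_div_normSq, im_smul_eq_div_normSq,
      Complex.normSq_eq_norm_sq, Complex.normSq_eq_norm_sq]
    have a1 := z.im_pos.ne'
    have a2 := w.im_pos.ne'
    have a3 := norm_ne_zero_iff.2 hz
    have a4 := norm_ne_zero_iff.2 hw
    have a5 : |g.val.det| ≠ 0 := abs_ne_zero.2 g.det_ne_zero
    have a6 : g.det.val = g.val.det := rfl
    rw [a6]
    field_simp
  exact Real.cosh_strictMonoOn.injOn dist_nonneg dist_nonneg h3

lemma dist_PGL_smul (g : PGL(2, ℝ)) (z w : ℍ) : dist (g • z) (g • w) = dist z w := by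
  induction g using Matrix.ProjGenLinGroup.induction_on with
  | mk g => exact dist_GL_smul g z w

lemma PGL_smul_base (g : PGL(2, ℝ)) (v : UnitTangent) : (g • v).base = g • v.base := by
  induction g using Matrix.ProjGenLinGroup.induction_on with
  | mk g => rfl

/-- The Euclidean gradient of `z ↦ cosh (dist z q)`. -/
def gradCosh (q z : ℍ) : ℂ :=
  -Complex.I * (((z : ℂ) - q) * ((z : ℂ) - conj (q : ℂ))) / ((2 * z.im ^ 2 * q.im : ℝ) : ℂ)

/-- The derivative of `cosh (dist · q)` in the direction `v`. -/
def radialSpeed (v : UnitTangent) (q : ℍ) : ℝ := (conj v.dir * gradCosh q v.base).re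

/-- The square of the conserved quantity of Clairaut's relation at `q`, shifted by one. -/
def clairaut (v : UnitTangent) (q : ℍ) : ℝ :=
  Real.cosh (dist v.base q) ^ 2 - radialSpeed v q ^ 2

lemma cosh_dist_eq (z q : ℍ) : Real.cosh (dist z q) =
    (z.re ^ 2 + z.im ^ 2 - 2 * z.re * q.re + q.re ^ 2 + q.im ^ 2) / (2 * z.im * q.im) := by
  have := z.im_pos.ne'
  have := q.im_pos.ne'
  rw [cosh_dist, Complex.dist_eq, ← Complex.normSq_eq_norm_sq, Complex.normSq_apply]
  simp only [Complex.sub_re, Complex.sub_im, coe_re, coe_im]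
  field_simp
  ring

lemma re_gradCosh (q z : ℍ) :
    (gradCosh q z).re = (z.re - q.re) / (z.im * q.im) := by
  have := z.im_pos.ne'
  have := q.im_pos.ne'
  rw [gradCosh, Complex.div_ofReal_re]
  simp
  field_simp
  ring

lemma im_gradCosh (q z : ℍ) :
    (gradCosh q z).im = (z.im ^ 2 - q.im ^ 2 - (z.re - q.re) ^ 2) / (2 * z.im ^ 2 * q.im) := by
  have := z.im_pos.ne'
  have := q.im_pos.ne'
  rw [gradCosh, Complex.div_ofReal_im]
  simp
  field_simp
  ring

lemma radialSpeed_eq (v : UnitTangent) (q : ℍ) : radialSpeed v q =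
    v.dir.re * (gradCosh q v.base).re + v.dir.im * (gradCosh q v.base).im := by
  simp [radialSpeed]

lemma normSq_gradCosh (q z : ℍ) :
    z.im ^ 2 * Complex.normSq (gradCosh q z) = Real.cosh (dist z q) ^ 2 - 1 := by
  have := z.im_pos.ne'
  have := q.im_pos.ne'
  rw [Complex.normSq_apply, re_gradCosh, im_gradCosh, cosh_dist_eq]
  field_simp
  ring

/-- This is the hyperbolic law of cosines for the triangle `z`, `p`, `q`: the gradients have
hyperbolic lengths `sinh (dist z q)` and `sinh (dist z p)`, and they enclose the angle at `z`. -/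
lemma re_gradCosh_mul_conj (p q z : ℍ) :
    z.im ^ 2 * (gradCosh q z * conj (gradCosh p z)).re =
      Real.cosh (dist z q) * Real.cosh (dist z p) - Real.cosh (dist p q) := by
  have := z.im_pos.ne'
  have := q.im_pos.ne'
  have := p.im_pos.ne'
  rw [Complex.mul_re, Complex.conj_re, Complex.conj_im, re_gradCosh, im_gradCosh, re_gradCosh,
    im_gradCosh, cosh_dist_eq, cosh_dist_eq, cosh_dist_eq]
  field_simp
  ring

lemma dir_normSq (v : UnitTangent) : v.dir.re ^ 2 + v.dir.im ^ 2 = v.base.im ^ 2 := by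
  rw [← v.norm_dir, ← Complex.normSq_eq_norm_sq, Complex.normSq_apply]; ring

/-- This is the solution of `f'' = f` with the initial data of `v`. It is verified from the explicit
formula for the flow; the only relations needed are `|dir| = y` and `cosh² - sinh² = 1` at `t / 2`.
-/
lemma cosh_dist_planeFlow (t : ℝ) (v : UnitTangent) (q : ℍ) :
    Real.cosh (dist (planeFlow t v).base q) =
      Real.cosh (dist v.base q) * Real.cosh t + radialSpeed v q * Real.sinh t := by
  have hy := v.base.im_pos.ne'
  have hq := q.im_pos.ne'
  have hD := flowDenom_ne_zero t v
  have hDn : Complex.normSq (flowDenom t v) ≠ 0 := by simpa using hD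
  have hc : Real.cosh t = Real.cosh (t / 2) ^ 2 + Real.sinh (t / 2) ^ 2 := by
    rw [← Real.cosh_two_mul]; ring_nf
  have hs : Real.sinh t = 2 * Real.sinh (t / 2) * Real.cosh (t / 2) := by
    rw [← Real.sinh_two_mul]; ring_nf
  have hC := Real.cosh_sq (t / 2)
  have hn := dir_normSq v
  have hsub : flowPoint t v - q =
      (Real.cosh (t / 2) * v.base.im * (v.base - q) +
        Complex.I * Real.sinh (t / 2) * v.dir * (conj (v.base : ℂ) - q)) / flowDenom t v := by
    rw [flowPoint, eq_div_iff hD, sub_mul, div_mul_cancel₀ _ hD, flowDenom]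
    ring
  rw [cosh_dist, Complex.dist_eq]
  change 1 + ‖flowPoint t v - q‖ ^ 2 / (2 * (flowPoint t v).im * q.im) = _
  rw [flowPoint_im, hsub, norm_div, ← Complex.normSq_eq_norm_sq, div_pow,
    ← Complex.normSq_eq_norm_sq, ← Complex.normSq_eq_norm_sq, radialSpeed_eq, re_gradCosh,
    im_gradCosh, cosh_dist_eq, hc, hs]
  have : Complex.normSq (Real.cosh (t / 2) * v.base.im * (v.base - q) +
        Complex.I * Real.sinh (t / 2) * v.dir * (conj (v.base : ℂ) - q)) =
      2 * v.base.im ^ 3 * q.im *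
        ((v.base.re ^ 2 + v.base.im ^ 2 - 2 * v.base.re * q.re + q.re ^ 2 + q.im ^ 2) /
          (2 * v.base.im * q.im) * (Real.cosh (t / 2) ^ 2 + Real.sinh (t / 2) ^ 2) +
        (v.dir.re * ((v.base.re - q.re) / (v.base.im * q.im)) +
          v.dir.im * ((v.base.im ^ 2 - q.im ^ 2 - (v.base.re - q.re) ^ 2) /
            (2 * v.base.im ^ 2 * q.im))) *
        (2 * Real.sinh (t / 2) * Real.cosh (t / 2)) - 1) := by
    field_simp
    rw [Complex.normSq_apply]
    simp only [Complex.add_im, Complex.mul_im, Complex.ofReal_re, Complex.ofReal_im,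
      Complex.add_re, Complex.mul_re, Complex.I_re, Complex.I_im, Complex.conj_re, Complex.conj_im,
      coe_re, coe_im, Complex.sub_re, Complex.sub_im]
    generalize Real.cosh (t / 2) = C at *
    generalize Real.sinh (t / 2) = S at *
    generalize v.dir.re = m at *
    generalize v.dir.im = n at *
    generalize v.base.im = y at *
    generalize v.base.re = x at *
    linear_combination (S ^ 2 * ((x - q.re) ^ 2 + (y + q.im) ^ 2)) * hn - 2 * y ^ 3 * q.im * hC
  rw [this]
  field_simp
  ring

lemma planeFlow_planeFlow (s t : ℝ) (v : UnitTangent) :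
    planeFlow s (planeFlow t v) = planeFlow (s + t) v := by
  have hy : (v.base.im : ℂ) ≠ 0 := by exact_mod_cast v.base.im_pos.ne'
  have hD := flowDenom_ne_zero t v
  have hDb : conj (flowDenom t v) ≠ 0 := by simpa using hD
  have hD' := flowDenom_ne_zero (s + t) v
  have him : ((planeFlow t v).base.im : ℂ) =
      v.base.im ^ 3 / (flowDenom t v * conj (flowDenom t v)) := by
    change (((flowPoint t v).im : ℝ) : ℂ) = _
    rw [flowPoint_im, Complex.mul_conj, Complex.normSq_eq_norm_sq]
    push_cast; rfl
  have hconj : conj (flowDenom t v) = Real.cosh (t / 2) * v.base.im -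
      Complex.I * Real.sinh (t / 2) * conj v.dir := by
    simp only [flowDenom, map_add, map_mul, Complex.conj_ofReal, Complex.conj_I]
    ring
  have hvv : v.dir * conj v.dir = v.base.im ^ 2 := by
    rw [Complex.mul_conj, Complex.normSq_eq_norm_sq, v.norm_dir]; push_cast; rfl
  have hC : (Real.cosh ((s + t) / 2) : ℂ) = Real.cosh (s / 2) * Real.cosh (t / 2) +
      Real.sinh (s / 2) * Real.sinh (t / 2) := by
    rw [add_div, Real.cosh_add]; push_cast; rfl
  have hS : (Real.sinh ((s + t) / 2) : ℂ) = Real.sinh (s / 2) * Real.cosh (t / 2) +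
      Real.cosh (s / 2) * Real.sinh (t / 2) := by
    rw [add_div, Real.sinh_add]; push_cast; rfl
  have hI := Complex.I_sq
  -- The cocycle relation of the denominators, which carries both halves of the group law.
  have hden : flowDenom s (planeFlow t v) =
      v.base.im ^ 3 * flowDenom (s + t) v / (flowDenom t v ^ 2 * conj (flowDenom t v)) := by
    rw [flowDenom, him]
    change _ + Complex.I * Real.sinh (s / 2) * (v.base.im ^ 2 * v.dir / flowDenom t v ^ 2) = _
    field_simp
    rw [hconj, flowDenom, flowDenom, hC, hS]
    linear_combination (-Real.sinh (s / 2) * Real.sinh (t / 2) * v.dir * conj v.dir : ℂ) * hI +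
      (Real.sinh (s / 2) * Real.sinh (t / 2)) * hvv
  refine UnitTangent.ext (UpperHalfPlane.ext ?_) ?_
  · change flowPoint s (planeFlow t v) = flowPoint (s + t) v
    have hcp : conj ((planeFlow t v).base : ℂ) =
        (Real.cosh (t / 2) * v.base.im * conj (v.base : ℂ) -
        Complex.I * Real.sinh (t / 2) * conj v.dir * v.base) / conj (flowDenom t v) := by
      change conj (flowPoint t v) = _
      rw [flowPoint, map_div₀]
      congr 1
      simp only [map_add, map_mul, Complex.conj_ofReal, Complex.conj_I, Complex.conj_conj]
      ring
    rw [flowPoint, hden, him, hcp]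
    change (_ * flowPoint t v + Complex.I * Real.sinh (s / 2) * (v.base.im ^ 2 * v.dir / flowDenom t v ^ 2) * _) /
      _ = _
    rw [flowPoint, flowPoint]
    field_simp
    rw [hC, hS]
    linear_combination (-Real.sinh (s / 2) * Real.sinh (t / 2) * v.dir * conj v.dir * v.base : ℂ) * hI +
      (Real.sinh (s / 2) * Real.sinh (t / 2) * v.base) * hvv
  · change flowVelocity s (planeFlow t v) = flowVelocity (s + t) v
    rw [flowVelocity, hden, him]
    change _ * (v.base.im ^ 2 * v.dir / flowDenom t v ^ 2) / _ = _
    rw [flowVelocity]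
    field_simp

/-- No differentiation is needed: the distance at time `1 + t` is expanded both from `v` and from
`planeFlow t v`, and the coefficients of `sinh 1` are compared. The time `1` is an arbitrary nonzero
choice. -/
lemma radialSpeed_planeFlow (t : ℝ) (v : UnitTangent) (q : ℍ) :
    radialSpeed (planeFlow t v) q =
      Real.cosh (dist v.base q) * Real.sinh t + radialSpeed v q * Real.cosh t := by
  have h := cosh_dist_planeFlow 1 (planeFlow t v) q
  rw [planeFlow_planeFlow, cosh_dist_planeFlow, cosh_dist_planeFlow, Real.cosh_add,
    Real.sinh_add] at h
  have h1 : Real.sinh 1 ≠ 0 := by simp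
  refine mul_right_cancel₀ h1 ?_
  linear_combination -h

lemma clairaut_planeFlow (t : ℝ) (v : UnitTangent) (q : ℍ) :
    clairaut (planeFlow t v) q = clairaut v q := by
  rw [clairaut, clairaut, radialSpeed_planeFlow, cosh_dist_planeFlow]
  linear_combination (Real.cosh (dist v.base q) ^ 2 - radialSpeed v q ^ 2) * Real.cosh_sq t

/-- The radial speed is determined by the distances at times `0` and `1`, and isometries preserve
these. -/
lemma radialSpeed_smul (g : PGL(2, ℝ)) (v : UnitTangent) (q : ℍ) :
    radialSpeed (g • v) (g • q) = radialSpeed v q := by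
  have h := cosh_dist_planeFlow 1 (g • v) (g • q)
  rw [planeFlow_smul, PGL_smul_base, PGL_smul_base, dist_PGL_smul, dist_PGL_smul,
    cosh_dist_planeFlow] at h
  have h1 : Real.sinh 1 ≠ 0 := by simp
  refine mul_right_cancel₀ h1 ?_
  linear_combination -h

lemma clairaut_smul (g : PGL(2, ℝ)) (v : UnitTangent) (q : ℍ) :
    clairaut (g • v) (g • q) = clairaut v q := by
  rw [clairaut, clairaut, radialSpeed_smul, PGL_smul_base, dist_PGL_smul]

lemma dist_planeFlow_self (t : ℝ) (v : UnitTangent) : dist (planeFlow t v).base v.base = |t| := by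
  have h := cosh_dist_planeFlow t v v.base
  have h0 : radialSpeed v v.base = 0 := by simp [radialSpeed, gradCosh]
  rw [h0, dist_self, Real.cosh_zero, one_mul, zero_mul, add_zero,
    ← Real.cosh_abs t] at h
  exact Real.cosh_strictMonoOn.injOn dist_nonneg (abs_nonneg t) h

/-! ### Tangent lines of distance circles -/

-- The tangent cone is a local object. This allows a union of circles to be replaced by the one
-- circle through `z`.
open Topology in
lemma tangentLine_congr {K K' : Set ℍ} {z : ℍ} (h : ∀ᶠ w in 𝓝 z, w ∈ K ↔ w ∈ K') :
    tangentLine K z = tangentLine K' z := by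
  have hU : (fun w : ℍ => (w : ℂ)) '' {w | w ∈ K ↔ w ∈ K'} ∈ 𝓝 (z : ℂ) :=
    isOpenEmbedding_coe.image_mem_nhds.2 h
  rw [tangentLine, tangentLine, ← tangentConeAt_inter_nhds hU,
    ← tangentConeAt_inter_nhds (s := _ '' K') hU]
  have inj : Function.Injective (fun w : ℍ => (w : ℂ)) := isOpenEmbedding_coe.injective
  rw [← Set.image_inter inj, ← Set.image_inter inj]
  have : K ∩ {w | w ∈ K ↔ w ∈ K'} = K' ∩ {w | w ∈ K ↔ w ∈ K'} := by
    ext w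
    simp only [Set.mem_inter_iff, Set.mem_ofPred_eq]
    tauto
  rw [this]

/-- A hyperbolic circle is a Euclidean circle with a shifted centre, and the gradient points along
its Euclidean radius. -/
lemma gradCosh_eq_sub_center {q z : ℍ} {r : ℝ} (h : dist z q = r) :
    (z : ℂ) - q.center r = ((z.im * q.im : ℝ) : ℂ) * gradCosh q z := by
  have hz := z.im_pos.ne'
  have hq := q.im_pos.ne'
  apply Complex.ext
  · rw [Complex.re_ofReal_mul, re_gradCosh, Complex.sub_re, coe_re, coe_re, center_re]
    field_simp
  · rw [Complex.im_ofReal_mul, im_gradCosh, Complex.sub_im, coe_im, coe_im, center_im, ← h,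
      cosh_dist_eq]
    field_simp
    ring

lemma gradCosh_ne_zero {q z : ℍ} (h : z ≠ q) : gradCosh q z ≠ 0 := by
  intro h0
  have h1 := normSq_gradCosh q z
  rw [h0, map_zero, mul_zero] at h1
  have h2 : 0 < dist z q := dist_pos.2 h
  have h3 := Real.one_lt_cosh.2 h2.ne'
  nlinarith

/-- The squared Euclidean distance to the centre is constant on the circle, so its derivative kills
the tangent cone. The inclusion into a line is an equality because the circle accumulates at `z`,
which gives a nonzero tangent vector. -/
lemma tangentLine_sphere {q z : ℍ} (h : z ≠ q) :
    tangentLine (Metric.sphere q (dist z q)) z = (Submodule.span ℝ {gradCosh q z})ᗮ := by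
  have hr : 0 < dist z q := dist_pos.2 h
  set r := dist z q with hrdef
  set c : ℂ := ((q.center r : ℍ) : ℂ)
  set R : ℝ := q.im * Real.sinh r
  have hR : 0 < R := mul_pos q.im_pos (Real.sinh_pos_iff.2 hr)
  have hg := gradCosh_eq_sub_center hrdef.symm
  have hzS : (z : ℂ) ∈ Metric.sphere c R := by
    rw [← image_coe_sphere]; exact ⟨z, hrdef.symm, rfl⟩
  have hle : tangentLine (Metric.sphere q r) z ≤ (Submodule.span ℝ {gradCosh q z})ᗮ := by
    rw [tangentLine, Submodule.span_le, image_coe_sphere]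
    intro u hu
    have hd : HasFDerivAt (fun w : ℂ => ‖w - c‖ ^ 2)
        (2 • (innerSL ℝ ((z : ℂ) - c)).comp (ContinuousLinearMap.id ℝ ℂ)) (z : ℂ) :=
      ((hasFDerivAt_id (z : ℂ)).sub_const c).norm_sq
    have h1 := hd.hasFDerivWithinAt (s := Metric.sphere c R) |>.mapsTo_tangent_cone hu
    have h2 : (fun w : ℂ => ‖w - c‖ ^ 2) '' Metric.sphere c R ⊆ {R ^ 2} := by
      rintro _ ⟨w, hw, rfl⟩
      simp [← mem_sphere_iff_norm.1 hw]
    have h3 := tangentConeAt_mono h2 h1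
    have h4 := tangentConeAt_subset_zero (x := ‖(z : ℂ) - c‖ ^ 2) (by
      rw [accPt_principal_iff_nhdsWithin]
      rw [mem_sphere_iff_norm.1 hzS]
      simp) h3
    rw [SetLike.mem_coe, Submodule.mem_orthogonal_singleton_iff_inner_right]
    have h5 : inner ℝ ((z : ℂ) - c) u = 0 := by
      simp at h4 ⊢
      linarith
    rw [hg, ← Complex.real_smul, real_inner_smul_left] at h5
    exact (mul_eq_zero.1 h5).resolve_left (mul_pos z.im_pos q.im_pos).ne'
  refine Submodule.eq_of_le_of_finrank_le hle ?_
  have hf : Module.finrank ℝ (Submodule.span ℝ {gradCosh q z})ᗮ = 1 := by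
    have := Submodule.finrank_add_finrank_orthogonal (Submodule.span ℝ {gradCosh q z})
    rw [finrank_span_singleton (gradCosh_ne_zero h), Complex.finrank_real_complex] at this
    omega
  rw [hf, Nat.one_le_iff_ne_zero, Ne, Submodule.finrank_eq_zero]
  intro h0
  have hacc : AccPt (z : ℂ) (Filter.principal (Metric.sphere c R)) := by
    refine IsPreconnected.preperfect_of_nontrivial ?_
      (isPreconnected_sphere (by simp) c R) _ hzS
    refine ⟨c + R, by simp [abs_of_pos hR], c - R, by simp [abs_of_pos hR], fun h => ?_⟩
    have h1 := congrArg Complex.re h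
    simp at h1
    linarith
  obtain ⟨u, hu, hu0⟩ := tangentConeAt_nonempty_of_properSpace (𝕜 := ℝ) hacc
  apply hu0
  have : u ∈ tangentLine (Metric.sphere q r) z := by
    rw [tangentLine, image_coe_sphere]
    exact Submodule.subset_span hu
  rw [h0] at this
  exact this

/-! ### Radial reflection in complex notation -/

lemma reflection_orthogonal_span_singleton {g : ℂ} (hg : g ≠ 0) (u : ℂ) :
    (Submodule.span ℝ {g})ᗮ.reflection u = -(g / conj g * conj u) := by
  have hgc : conj g ≠ 0 := by simpa using hg
  rw [Submodule.reflection_orthogonal_apply, Submodule.reflection_apply,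
    Submodule.starProjection_singleton]
  simp only [Complex.inner, Complex.real_smul, RCLike.ofReal_real_eq_id, id]
  have h1 : (((u * conj g).re : ℝ) : ℂ) = (u * conj g + conj u * g) / 2 := by
    rw [Complex.re_eq_add_conj]; simp
  have h2 : ((‖g‖ : ℝ) : ℂ) ^ 2 = g * conj g := by
    rw [Complex.mul_conj, Complex.normSq_eq_norm_sq]; push_cast; rfl
  push_cast
  rw [h1, h2, two_smul]
  field_simp
  ring

/-- The unit vector obtained from `v` by reversing its component along the gradient of the distance
to `q`. -/
def radialReflection (q : ℍ) (v : UnitTangent) : UnitTangent where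
  base := v.base
  dir := (Submodule.span ℝ {gradCosh q v.base})ᗮ.reflection v.dir
  norm_dir := by rw [LinearIsometryEquiv.norm_map, v.norm_dir]

lemma radialReflection_base (q : ℍ) (v : UnitTangent) :
    (radialReflection q v).base = v.base := rfl

lemma radialReflection_dir {q : ℍ} {v : UnitTangent} (h : v.base ≠ q) :
    (radialReflection q v).dir =
      -(gradCosh q v.base / conj (gradCosh q v.base) * conj v.dir) :=
  reflection_orthogonal_span_singleton (gradCosh_ne_zero h) _

lemma radialSpeed_radialReflection {q : ℍ} {v : UnitTangent} (h : v.base ≠ q) :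
    radialSpeed (radialReflection q v) q = -radialSpeed v q := by
  have hg := gradCosh_ne_zero h
  have hgc : conj (gradCosh q v.base) ≠ 0 := by simpa using hg
  rw [radialSpeed, radialReflection_dir h, radialReflection_base, radialSpeed, ← Complex.neg_re,
    ← Complex.conj_re (-(_ * _))]
  congr 1
  simp only [map_neg, map_mul, map_div₀, Complex.conj_conj]
  field_simp

lemma clairaut_radialReflection {q : ℍ} {v : UnitTangent} (h : v.base ≠ q) :
    clairaut (radialReflection q v) q = clairaut v q := by
  rw [clairaut, clairaut, radialSpeed_radialReflection h, radialReflection_base, neg_sq]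

/-! ### Unions of separated distance circles -/

/-- The union of the distance circles of radius `r` around the points of `O`. -/
def circleUnion (O : Set ℍ) (r : ℝ) : Set ℍ := {w | ∃ q ∈ O, dist w q = r}

/-- The distances between different points of `O` are at least `2 ρ`. -/
def Separated (O : Set ℍ) (ρ : ℝ) : Prop := ∀ q ∈ O, ∀ q' ∈ O, q ≠ q' → 2 * ρ ≤ dist q q'

section Separated

variable {O : Set ℍ} {r ρ : ℝ}

/-- By the triangle inequality, circles around different centres are at least `2 * (ρ - r)` apart.
-/
lemma Separated.eq_of_dist (hO : Separated O ρ) {z w q q' : ℍ} (hq : q ∈ O)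
    (hq' : q' ∈ O) (hz : dist z q = r) (hw : dist w q' = r) (hzw : dist w z < 2 * (ρ - r)) :
    q = q' := by
  by_contra hne
  have h1 := hO q hq q' hq' hne
  have h2 : dist q q' ≤ dist z q + dist w z + dist w q' := by
    have := dist_triangle4 q z w q'
    rw [dist_comm q z, dist_comm z w] at this
    exact this
  linarith

lemma Separated.tangentLine_circleUnion (hO : Separated O ρ) (hr : 0 < r) (hrρ : r < ρ) {z q : ℍ}
    (hq : q ∈ O) (hz : dist z q = r) :
    tangentLine (circleUnion O r) z = (Submodule.span ℝ {gradCosh q z})ᗮ := by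
  have hzq : z ≠ q := dist_pos.1 (hz ▸ hr)
  rw [← tangentLine_sphere hzq]
  refine tangentLine_congr ?_
  filter_upwards [Metric.ball_mem_nhds z (show 0 < 2 * (ρ - r) by linarith)] with w hw
  rw [Metric.mem_sphere, hz]
  constructor
  · rintro ⟨q', hq', hw'⟩
    rwa [hO.eq_of_dist hq hq' hz hw' hw]
  · intro h
    exact ⟨q, hq, h⟩

lemma Separated.planeReflection_circleUnion (hO : Separated O ρ) (hr : 0 < r) (hrρ : r < ρ)
    {v : UnitTangent} {q : ℍ} (hq : q ∈ O) (hz : dist v.base q = r) :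
    planeReflection (circleUnion O r) v = radialReflection q v := by
  refine UnitTangent.ext rfl ?_
  simp only [planeReflection, radialReflection]
  congr 1
  simp only [hO.tangentLine_circleUnion hr hrρ hq hz]

/-- The balls of radius `ρ` around the points are disjoint open sets in a separable space. -/
lemma Separated.countable (hO : Separated O ρ) (hρ : 0 < ρ) : O.Countable := by
  refine Set.PairwiseDisjoint.countable_of_isOpen (s := fun q => Metric.ball q ρ) ?_
    (fun q _ => Metric.isOpen_ball) (fun q _ => ⟨q, Metric.mem_ball_self hρ⟩)
  intro q hq q' hq' hne
  refine Metric.ball_disjoint_ball ?_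
  linarith [hO q hq q' hq' hne]

lemma Separated.mem_circleUnion_iff_infDist (hO : Separated O ρ) (hr : 0 < r) (hrρ : r < ρ)
    (w : ℍ) : w ∈ circleUnion O r ↔ Metric.infDist w O = r := by
  have key : ∀ q ∈ O, dist w q < ρ → Metric.infDist w O = dist w q := by
    intro q hq hw
    refine le_antisymm (Metric.infDist_le_dist_of_mem hq) ?_
    refine (Metric.le_infDist ⟨q, hq⟩).2 fun q' hq' => ?_
    by_cases hne : q = q'
    · rw [hne]
    · have h1 := hO q hq q' hq' hne
      have h2 := dist_triangle_left q q' w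
      linarith
  constructor
  · rintro ⟨q, hq, h⟩
    rw [key q hq (h ▸ hrρ), h]
  · intro h
    -- For empty `O` the default value `infDist = 0` differs from `r > 0`.
    have hne : O.Nonempty := by
      by_contra h0
      rw [Set.not_nonempty_iff_eq_empty.1 h0, Metric.infDist_empty] at h
      linarith
    obtain ⟨q, hq, hw⟩ := (Metric.infDist_lt_iff hne).1 (h ▸ hrρ)
    exact ⟨q, hq, by rw [← key q hq hw, h]⟩

lemma Separated.isClosed_circleUnion (hO : Separated O ρ) (hr : 0 < r) (hrρ : r < ρ) :
    IsClosed (circleUnion O r) := by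
  have : circleUnion O r = {w | Metric.infDist w O = r} :=
    Set.ext (hO.mem_circleUnion_iff_infDist hr hrρ)
  rw [this]
  exact isClosed_eq (Metric.continuous_infDist_pt O) continuous_const

end Separated

/-! ### Geodesics starting on a union of separated circles -/

lemma continuous_planeFlow_base (v : UnitTangent) :
    Continuous fun t => (planeFlow t v).base := by
  rw [isOpenEmbedding_coe.isInducing.continuous_iff]
  exact continuous_iff_continuousAt.2 fun t => (planeFlow_hasDerivAt_base t v).continuousAt

/-- A geodesic starting on a circle meets it at one other time at most. -/
lemma cosh_mul_add_sinh_mul_unique {a b t s : ℝ} (ha : a ≠ 0) (ht0 : t ≠ 0) (hs0 : s ≠ 0)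
    (ht : a * Real.cosh t + b * Real.sinh t = a) (hs : a * Real.cosh s + b * Real.sinh s = a) :
    t = s := by
  -- Half-argument formulas turn the equation for `u ≠ 0` into `tanh (u / 2) = -b / a`, which
  -- determines `u`.
  have half : ∀ u : ℝ, u ≠ 0 → a * Real.cosh u + b * Real.sinh u = a →
      a * Real.sinh (u / 2) + b * Real.cosh (u / 2) = 0 := by
    intro u hu h
    have hc : Real.cosh u = 2 * Real.sinh (u / 2) ^ 2 + 1 := by
      have := Real.cosh_two_mul (u / 2)
      rw [Real.cosh_sq] at this
      rw [← mul_div_cancel₀ u two_ne_zero, mul_div_assoc, this]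
      ring_nf
    have hsn : Real.sinh u = 2 * Real.sinh (u / 2) * Real.cosh (u / 2) := by
      rw [← Real.sinh_two_mul]; ring_nf
    have hu' : Real.sinh (u / 2) ≠ 0 := by simpa using hu
    refine (mul_eq_zero.1 (?_ : Real.sinh (u / 2) * _ = 0)).resolve_left hu'
    rw [hc, hsn] at h
    linear_combination h / 2
  have h1 := half t ht0 ht
  have h2 := half s hs0 hs
  have h3 : Real.sinh (t / 2 - s / 2) = 0 := by
    rw [Real.sinh_sub]
    refine (mul_eq_zero.1 (?_ : a * _ = 0)).resolve_left ha
    linear_combination Real.cosh (s / 2) * h1 - Real.cosh (t / 2) * h2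
  have := Real.sinh_eq_zero.1 h3
  linarith

/-- For a short time only the circle of departure is within reach, and the geodesic meets that
circle at no more than one nonzero time. This covers tangential vectors as well, and it ensures that
return times do not vanish. -/
lemma Separated.exists_pos_forall_notMem {O : Set ℍ} {r ρ : ℝ} (hO : Separated O ρ)
    (hrρ : r < ρ) (v : UnitTangent) (hv : v.base ∈ circleUnion O r) :
    ∃ ε > 0, ∀ t, t ≠ 0 → |t| < ε → (planeFlow t v).base ∉ circleUnion O r := by
  obtain ⟨q, hq, hz⟩ := hv
  have hch := (Real.cosh_pos r).ne'
  have hmem : ∀ t, |t| < 2 * (ρ - r) → (planeFlow t v).base ∈ circleUnion O r →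
      Real.cosh r * Real.cosh t + radialSpeed v q * Real.sinh t = Real.cosh r := by
    rintro t ht ⟨q', hq', hw⟩
    obtain rfl := hO.eq_of_dist hq hq' hz hw (by rwa [dist_planeFlow_self])
    rw [← hz, ← cosh_dist_planeFlow, hw, hz]
  by_cases h : ∃ s, s ≠ 0 ∧ Real.cosh r * Real.cosh s + radialSpeed v q * Real.sinh s = Real.cosh r
  · obtain ⟨s, hs0, hs⟩ := h
    refine ⟨min |s| (2 * (ρ - r)), lt_min (abs_pos.2 hs0) (by linarith), fun t ht0 ht hm => ?_⟩
    have := cosh_mul_add_sinh_mul_unique hch ht0 hs0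
      (hmem t (ht.trans_le (min_le_right _ _)) hm) hs
    exact absurd (this ▸ ht.trans_le (min_le_left _ _)) (lt_irrefl _)
  · exact ⟨2 * (ρ - r), by linarith, fun t ht0 ht hm => h ⟨t, ht0, hmem t ht hm⟩⟩

/-! ### Return times -/

section ReturnTimes

variable {X : Type*} {φ : ℝ → X → X} {S : Set X}

lemma firstReturnTime_mem (h0 : ∀ x, φ 0 x = x) (hcl : ∀ x, IsClosed {t : ℝ | φ t x ∈ S}) {x : X}
    (hx : x ∈ S) :
    φ (firstReturnTime φ S x).toReal x ∈ S := by
  set T := firstReturnTime φ S x with hT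
  -- Here `(⊤).toReal = 0`, and the claim reduces to `x ∈ S`.
  by_cases htop : T = ⊤
  · rw [htop, ENNReal.toReal_top, h0]
    exact hx
  have : T.toReal ∈ closure {t : ℝ | φ t x ∈ S} := by
    rw [Metric.mem_closure_iff]
    intro ε hε
    have hlt : T < T + ENNReal.ofReal ε := ENNReal.lt_add_right htop (by simpa using hε)
    conv_lhs at hlt => rw [hT, firstReturnTime]
    simp only [iInf_lt_iff] at hlt
    obtain ⟨t, ht0, htS, ht⟩ := hlt
    refine ⟨t, htS, ?_⟩
    have hle : T ≤ ENNReal.ofReal t := iInf_le_of_le t (iInf_le_of_le ht0 (iInf_le _ htS))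
    have h1 := ENNReal.toReal_mono ENNReal.ofReal_ne_top hle
    rw [ENNReal.toReal_ofReal ht0.le] at h1
    have h2 := (ENNReal.toReal_lt_toReal ENNReal.ofReal_ne_top (by simp [htop])).2 ht
    rw [ENNReal.toReal_ofReal ht0.le, ENNReal.toReal_add htop ENNReal.ofReal_ne_top,
      ENNReal.toReal_ofReal hε.le] at h2
    rw [Real.dist_eq, abs_lt]
    constructor <;> linarith
  rwa [(hcl x).closure_eq] at this

lemma firstReturnTime_pos {x : X} (h : ∃ ε > 0, ∀ t, 0 < t → t < ε → φ t x ∉ S) :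
    0 < firstReturnTime φ S x := by
  obtain ⟨ε, hε, h⟩ := h
  refine (ENNReal.ofReal_pos.2 hε).trans_le ?_
  refine le_iInf fun t => le_iInf fun ht => le_iInf fun hS => ENNReal.ofReal_le_ofReal ?_
  by_contra hlt
  exact h t ht (not_le.1 hlt) hS

lemma forwardReturnTime_mem (h0 : ∀ x, φ 0 x = x) (hadd : ∀ s t x, φ s (φ t x) = φ (s + t) x)
    (hcl : ∀ x, IsClosed {t : ℝ | φ t x ∈ S}) {x : X} (hx : x ∈ S) (j : ℕ)
    (hj : forwardReturnTime φ S j x ≠ ⊤) :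
    φ (forwardReturnTime φ S j x).toReal x ∈ S := by
  induction j with
  | zero => simpa [forwardReturnTime, h0] using hx
  | succ j ih =>
    rw [forwardReturnTime] at hj ⊢
    obtain ⟨h1, h2⟩ := ENNReal.add_ne_top.1 hj
    rw [ENNReal.toReal_add h1 h2, add_comm, ← hadd]
    exact firstReturnTime_mem h0 hcl (ih h1)

/-- Only the first return has to be bounded away from zero; later summands are nonnegative. -/
lemma forwardReturnTime_pos (h0 : ∀ x, φ 0 x = x) {x : X}
    (h : ∃ ε > 0, ∀ t, 0 < t → t < ε → φ t x ∉ S) (j : ℕ) :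
    0 < forwardReturnTime φ S (j + 1) x := by
  induction j with
  | zero =>
    rw [forwardReturnTime, forwardReturnTime, ENNReal.toReal_zero, h0, zero_add]
    exact firstReturnTime_pos h
  | succ j ih => exact ih.trans_le (by
      conv_rhs => rw [forwardReturnTime]
      exact le_self_add)

/-- This is all that the argument uses about return times; the index `j` plays no further role.
Negative indices reduce to positive ones for the reversed flow. -/
lemma returnTime_mem (h0 : ∀ x, φ 0 x = x) (hadd : ∀ s t x, φ s (φ t x) = φ (s + t) x)
    (hcl : ∀ x, IsClosed {t : ℝ | φ t x ∈ S})
    {x : X} (hx : x ∈ S) (h : ∃ ε > 0, ∀ t, t ≠ 0 → |t| < ε → φ t x ∉ S)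
    {j : ℤ} (hj : j ≠ 0) {t : ℝ} (ht : returnTime φ S j x = (t : EReal)) :
    t ≠ 0 ∧ φ t x ∈ S := by
  obtain ⟨ε, hε, h⟩ := h
  have aux : ∀ (T : ℝ≥0∞) (s : ℝ), (T : EReal) = (s : EReal) → T ≠ ⊤ ∧ T.toReal = s := by
    intro T s hT
    have hT' : T ≠ ⊤ := by
      rintro rfl
      simp at hT
    refine ⟨hT', ?_⟩
    have := congrArg EReal.toReal hT
    simpa using this
  match j, hj, ht with
  | Int.ofNat 0, hj, _ => exact absurd rfl hj
  | Int.ofNat (n + 1), _, ht =>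
    obtain ⟨h1, h2⟩ := aux _ _ ht
    have hm := forwardReturnTime_mem h0 hadd hcl hx _ h1
    have hp := forwardReturnTime_pos (S := S) h0 (x := x)
      ⟨ε, hε, fun t ht hlt => h t ht.ne' (by rwa [abs_of_pos ht])⟩ n
    rw [← h2]
    exact ⟨(ENNReal.toReal_pos hp.ne' h1).ne', hm⟩
  | Int.negSucc n, _, ht =>
    have ht' : (forwardReturnTime (fun t => φ (-t)) S (n + 1) x : EReal) = ((-t : ℝ) : EReal) := by
      rw [EReal.coe_neg, ← ht, returnTime, neg_neg]
    obtain ⟨h1, h2⟩ := aux _ _ ht'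
    have h0' : ∀ x, φ (-0) x = x := by simpa using h0
    have hm := forwardReturnTime_mem (φ := fun t => φ (-t)) (S := S) h0'
      (fun s t x => by rw [hadd, neg_add]) (fun x => (hcl x).preimage continuous_neg) hx _ h1
    have hp := forwardReturnTime_pos (φ := fun t => φ (-t)) (S := S) h0' (x := x)
      ⟨ε, hε, fun t ht hlt => h (-t) (by simpa using ht.ne') (by rwa [abs_neg, abs_of_pos ht])⟩ n
    have hpos := ENNReal.toReal_pos hp.ne' h1
    rw [h2] at hm hpos
    rw [neg_neg] at hm
    exact ⟨by rintro rfl; simp at hpos, hm⟩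

end ReturnTimes

/-! ### Intersections of distance circles -/

lemma finite_setOf_sq_add_mul_add_eq_zero (b c : ℝ) : {u : ℝ | u ^ 2 + b * u + c = 0}.Finite := by
  rcases Set.eq_empty_or_nonempty {u : ℝ | u ^ 2 + b * u + c = 0} with h | ⟨u, hu⟩
  · rw [h]; exact Set.finite_empty
  · refine (Set.toFinite {u, -b - u}).subset fun w hw => ?_
    simp only [Set.mem_ofPred_eq] at hu hw
    have : (w - u) * (w - (-b - u)) = 0 := by linear_combination hw - hu
    rcases mul_eq_zero.1 this with h | h
    · exact Or.inl (sub_eq_zero.1 h)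
    · exact Or.inr (sub_eq_zero.1 h)

lemma finite_circle_inter_line (b c d α β δ : ℝ) (h : α ≠ 0 ∨ β ≠ 0) :
    {z : ℍ | z.re ^ 2 + z.im ^ 2 + b * z.re + c * z.im + d = 0 ∧
      α * z.re + β * z.im + δ = 0}.Finite := by
  have hN : α ^ 2 + β ^ 2 ≠ 0 := by
    rcases h with h | h <;> positivity
  -- This is a coordinate along the line: it is injective there, and on the circle it satisfies a
  -- monic quadratic equation.
  refine Set.Finite.of_finite_image (f := fun z : ℍ => β * z.re - α * z.im) ?_ ?_
  · refine (finite_setOf_sq_add_mul_add_eq_zero (b * β - c * α)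
      (δ ^ 2 - b * α * δ - c * β * δ + d * (α ^ 2 + β ^ 2))).subset ?_
    rintro _ ⟨z, ⟨h1, h2⟩, rfl⟩
    simp only [Set.mem_ofPred_eq]
    linear_combination (α ^ 2 + β ^ 2) * h1 + (δ - α * z.re - β * z.im - b * α - c * β) * h2
  · rintro z ⟨-, hz⟩ w ⟨-, hw⟩ hzw
    simp only at hzw
    refine UpperHalfPlane.ext (Complex.ext ?_ ?_)
    · refine mul_left_cancel₀ hN ?_
      simp only [coe_re]
      linear_combination β * hzw + α * (hz - hw)
    · refine mul_left_cancel₀ hN ?_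
      simp only [coe_im]
      linear_combination -α * hzw + β * (hz - hw)

lemma circle_equation {z p : ℍ} {m : ℝ} (h : Real.cosh (dist z p) = m) :
    z.re ^ 2 + z.im ^ 2 + (-2 * p.re) * z.re + (-2 * p.im * m) * z.im +
      (p.re ^ 2 + p.im ^ 2) = 0 := by
  have := z.im_pos.ne'
  have := p.im_pos.ne'
  rw [cosh_dist_eq, div_eq_iff (by positivity)] at h
  linear_combination h

/-- Subtracting the Euclidean equations leaves the radical line. It degenerates only for concentric
Euclidean circles, and a common point `w` then forces `p = q`. -/
lemma finite_circle_inter_circle {p q : ℍ} (hpq : p ≠ q) (r m : ℝ) :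
    {z : ℍ | dist z p = r ∧ Real.cosh (dist z q) = m}.Finite := by
  rcases Set.eq_empty_or_nonempty {z : ℍ | dist z p = r ∧ Real.cosh (dist z q) = m} with h | ⟨w, hw⟩
  · rw [h]; exact Set.finite_empty
  refine (finite_circle_inter_line (-2 * p.re) (-2 * p.im * Real.cosh r) (p.re ^ 2 + p.im ^ 2)
    (-2 * p.re + 2 * q.re) (-2 * p.im * Real.cosh r + 2 * q.im * m)
    (p.re ^ 2 + p.im ^ 2 - q.re ^ 2 - q.im ^ 2) ?_).subset ?_
  · by_contra! h
    obtain ⟨h1, h2⟩ := h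
    have e1 := circle_equation (congrArg Real.cosh hw.1)
    have e2 := circle_equation hw.2
    have hre : p.re = q.re := by linarith
    have him : p.im ^ 2 = q.im ^ 2 := by
      linear_combination e1 - e2 - w.re * h1 - w.im * h2 - (p.re + q.re) * hre
    refine hpq (UpperHalfPlane.ext (Complex.ext hre ?_))
    exact (sq_eq_sq₀ p.im_pos.le q.im_pos.le).1 him
  · rintro z ⟨h1, h2⟩
    have e1 := circle_equation (congrArg Real.cosh h1)
    have e2 := circle_equation h2
    exact ⟨e1, by linear_combination e1 - e2⟩

/-- Weighting the equations around `q` and `q'` by `q'.im` and `q.im` cancels the unknown common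
distance; subtracting `q'.im - q.im` times the equation around `p` then removes the quadratic terms.
-/
lemma finite_circle_inter_bisector {q q' : ℍ} (hq : q ≠ q') (p : ℍ) (r : ℝ) :
    {z : ℍ | dist z p = r ∧ dist z q = dist z q'}.Finite := by
  have hp0 := p.im_pos
  have hch := Real.cosh_pos r
  refine (finite_circle_inter_line (-2 * p.re) (-2 * p.im * Real.cosh r) (p.re ^ 2 + p.im ^ 2)
    (-2 * (q.re * q'.im - q'.re * q.im) + 2 * (q'.im - q.im) * p.re)
    (2 * (q'.im - q.im) * p.im * Real.cosh r)
    ((q.re ^ 2 + q.im ^ 2) * q'.im - (q'.re ^ 2 + q'.im ^ 2) * q.im -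
      (q'.im - q.im) * (p.re ^ 2 + p.im ^ 2)) ?_).subset ?_
  · by_contra! h
    obtain ⟨h1, h2⟩ := h
    have him : q'.im - q.im = 0 := by
      have : 2 * p.im * Real.cosh r ≠ 0 := by positivity
      refine (mul_eq_zero.1 (?_ : 2 * p.im * Real.cosh r * _ = 0)).resolve_left this
      linear_combination h2
    have hre : q.re = q'.re := by
      refine mul_right_cancel₀ q.im_pos.ne' ?_
      linear_combination -h1 / 2 + (p.re - q.re) * him
    exact hq (UpperHalfPlane.ext (Complex.ext hre (by simp only [coe_im]; linarith)))
  · rintro z ⟨h1, h2⟩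
    have e1 := circle_equation (congrArg Real.cosh h1)
    have e2 := circle_equation (z := z) (p := q) rfl
    have e3 := circle_equation (z := z) (p := q') rfl
    rw [h2] at e2
    refine ⟨e1, ?_⟩
    linear_combination q'.im * e2 - q.im * e3 - (q'.im - q.im) * e1

/-! ### Clairaut's relation and reflection -/

/-- The double-angle identity `2 (Re X)² = |X|² + Re X²` isolates the dependence on the direction as
a pure second harmonic. -/
lemma clairaut_eq (v : UnitTangent) (q : ℍ) : clairaut v q =
    (Real.cosh (dist v.base q) ^ 2 + 1 - ((conj v.dir * gradCosh q v.base) ^ 2).re) / 2 := by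
  have h1 := normSq_gradCosh q v.base
  have h2 := dir_normSq v
  rw [Complex.normSq_apply] at h1
  rw [clairaut, radialSpeed, sq (_ * _), Complex.mul_re (conj _ * _), Complex.mul_re,
    Complex.mul_im, Complex.conj_re, Complex.conj_im]
  generalize v.dir.re = m at *
  generalize v.dir.im = n at *
  generalize (gradCosh q v.base).re = a at *
  generalize (gradCosh q v.base).im = b at *
  linear_combination h1 / (-2) + (-(a ^ 2 + b ^ 2) / 2) * h2

/-- The coefficient of the second harmonic in the angle of the difference of the Clairaut quantities
of a vector at `q` and of the reflected vector at `q'`. -/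
def clairautCoeff (p q q' z : ℍ) : ℂ :=
  gradCosh q z ^ 2 - (gradCosh p z / conj (gradCosh p z) * conj (gradCosh q' z)) ^ 2

lemma clairaut_eq_clairaut_radialReflection_iff {p : ℍ} {v : UnitTangent} (h : v.base ≠ p)
    (q q' : ℍ) : clairaut v q = clairaut (radialReflection p v) q' ↔
      Real.cosh (dist v.base q) ^ 2 - Real.cosh (dist v.base q') ^ 2 =
        (conj v.dir ^ 2 * clairautCoeff p q q' v.base).re := by
  have key : (conj v.dir ^ 2 * clairautCoeff p q q' v.base).re =
      ((conj v.dir * gradCosh q v.base) ^ 2).re -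
        ((conj (radialReflection p v).dir * gradCosh q' v.base) ^ 2).re := by
    -- Reflection is antilinear in the direction, so conjugating this term makes `conj v.dir ^ 2` a
    -- common factor.
    rw [← Complex.conj_re ((conj (radialReflection p v).dir * gradCosh q' v.base) ^ 2),
      ← Complex.sub_re, radialReflection_dir h, clairautCoeff]
    congr 1
    simp only [map_neg, map_mul, map_div₀, map_pow, Complex.conj_conj]
    ring
  rw [clairaut_eq, clairaut_eq, key, radialReflection_base]
  constructor <;> intro h <;> linarith

lemma finite_angles (A : ℂ) (κ : ℝ) (h : A ≠ 0 ∨ κ ≠ 0) :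
    {θ : ℝ | θ ∈ Set.Ioc (-Real.pi) Real.pi ∧
      κ = (conj (Complex.exp (θ * Complex.I)) ^ 2 * A).re}.Finite := by
  -- On the unit circle the equation multiplied by `2 * w ^ 2` becomes this quartic in `w = exp (θ *
  -- I)`; its coefficients in degrees 0 and 2 detect `A` and `κ`.
  let P : Polynomial ℂ := Polynomial.C (conj A) * Polynomial.X ^ 4 -
    Polynomial.C (2 * κ : ℂ) * Polynomial.X ^ 2 + Polynomial.C A
  have hP : P ≠ 0 := by
    intro h0
    have c0 : P.coeff 0 = A := by simp [P]
    have c2 : P.coeff 2 = -(2 * κ) := by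
      simp only [P, Polynomial.coeff_add, Polynomial.coeff_sub, Polynomial.coeff_C_mul,
        Polynomial.coeff_X_pow, Polynomial.coeff_C]
      norm_num
    rw [h0, Polynomial.coeff_zero] at c0 c2
    rcases h with h | h
    · exact h c0.symm
    · apply h
      simpa using c2.symm
  refine (P.roots.toFinset.finite_toSet.image Complex.arg).subset ?_
  rintro θ ⟨hθ, hκ⟩
  refine ⟨Complex.exp (θ * Complex.I), ?_, ?_⟩
  · rw [Finset.mem_coe, Multiset.mem_toFinset, Polynomial.mem_roots hP, Polynomial.IsRoot.def]
    have hκ' : (κ : ℂ) = _ := congrArg Complex.ofReal hκ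
    rw [Complex.re_eq_add_conj] at hκ'
    have hw : Complex.exp (θ * Complex.I) * conj (Complex.exp (θ * Complex.I)) = 1 := by
      rw [Complex.mul_conj, Complex.normSq_eq_norm_sq, Complex.norm_exp_ofReal_mul_I]; simp
    simp only [map_mul, map_pow, Complex.conj_conj] at hκ'
    simp only [P, Polynomial.eval_add, Polynomial.eval_sub, Polynomial.eval_mul,
      Polynomial.eval_C, Polynomial.eval_pow, Polynomial.eval_X]
    generalize Complex.exp (θ * Complex.I) = w at *
    generalize conj w = w' at *
    linear_combination (-2 * w ^ 2) * hκ' - (A * (w * w' + 1)) * hw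
  · rw [Complex.arg_exp_mul_I, toIocMod_eq_self]
    rwa [show -Real.pi + 2 * Real.pi = Real.pi by ring]

/-- If `q ≠ q'`, the first equation puts `z` on their bisector. If `q = q' ≠ p`, the vanishing
coefficient makes the gradients at `z` towards `p` and `q` perpendicular or parallel, and the law of
cosines leaves three possible values of `cosh (dist z q)`. -/
lemma finite_exceptional_points {p q q' : ℍ} (h : q ≠ p ∨ q' ≠ p) {r : ℝ} (hr : 0 < r) :
    {z : ℍ | dist z p = r ∧ Real.cosh (dist z q) ^ 2 - Real.cosh (dist z q') ^ 2 = 0 ∧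
      clairautCoeff p q q' z = 0}.Finite := by
  by_cases hq : q = q'
  · subst hq
    have hqp : p ≠ q := by rcases h with h | h <;> exact h.symm
    set k := Real.cosh (dist p q) with hk
    set a := Real.cosh r with ha
    have ha0 : a ≠ 0 := (Real.cosh_pos r).ne'
    set D := Real.sqrt ((k ^ 2 - 1) * (a ^ 2 - 1))
    refine (((finite_circle_inter_circle hqp r (k / a)).union
      (finite_circle_inter_circle hqp r (k * a + D))).union
      (finite_circle_inter_circle hqp r (k * a - D))).subset ?_
    rintro z ⟨h1, -, h3⟩
    have hzp : z ≠ p := dist_pos.1 (h1 ▸ hr)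
    have hg : conj (gradCosh p z) ≠ 0 := by simpa using gradCosh_ne_zero hzp
    -- A real square means that the product is real (parallel gradients) or imaginary (perpendicular
    -- gradients).
    have h4 : ((gradCosh q z * conj (gradCosh p z)) ^ 2).im = 0 := by
      rw [clairautCoeff, sub_eq_zero, div_mul_eq_mul_div, div_pow,
        eq_div_iff (pow_ne_zero 2 hg)] at h3
      rw [← Complex.conj_eq_iff_im]
      simp only [map_pow, map_mul, Complex.conj_conj]
      linear_combination -h3
    have hre := re_gradCosh_mul_conj p q z
    have hn := normSq_gradCosh q z
    have hn' := normSq_gradCosh p z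
    rw [h1] at hre hn'
    have hmul : Complex.normSq (gradCosh q z * conj (gradCosh p z)) =
        Complex.normSq (gradCosh q z) * Complex.normSq (gradCosh p z) := by
      rw [map_mul, Complex.normSq_conj]
    rw [Complex.normSq_apply (_ * _)] at hmul
    rw [sq, Complex.mul_im (_ * _)] at h4
    have hy := z.im_pos.ne'
    generalize (gradCosh q z * conj (gradCosh p z)).re = R at *
    generalize (gradCosh q z * conj (gradCosh p z)).im = J at *
    generalize Complex.normSq (gradCosh q z) = N at *
    generalize Complex.normSq (gradCosh p z) = N' at *
    have h5 : R * J = 0 := by linarith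
    rcases mul_eq_zero.1 h5 with h6 | h6
    · refine Or.inl (Or.inl ⟨h1, ?_⟩)
      rw [eq_div_iff ha0]
      rw [h6] at hre
      linarith
    · rw [h6] at hmul
      have h7 : (Real.cosh (dist z q) - k * a) ^ 2 = (k ^ 2 - 1) * (a ^ 2 - 1) := by
        have e1 : (z.im ^ 2 * R) ^ 2 = (z.im ^ 2 * N) * (z.im ^ 2 * N') := by
          linear_combination z.im ^ 4 * hmul
        rw [hre, hn, hn'] at e1
        linear_combination e1
      have h8 : D ^ 2 = (k ^ 2 - 1) * (a ^ 2 - 1) := Real.sq_sqrt (h7 ▸ sq_nonneg _)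
      rw [← h8, sq_eq_sq_iff_eq_or_eq_neg] at h7
      rcases h7 with h7 | h7
      · exact Or.inl (Or.inr ⟨h1, by linarith⟩)
      · exact Or.inr ⟨h1, by linarith⟩
  · refine (finite_circle_inter_bisector hq p r).subset ?_
    rintro z ⟨h1, h2, -⟩
    refine ⟨h1, ?_⟩
    have h3 : Real.cosh (dist z q) = Real.cosh (dist z q') :=
      (sq_eq_sq₀ (Real.cosh_pos _).le (Real.cosh_pos _).le).1 (sub_eq_zero.1 h2)
    exact Real.cosh_strictMonoOn.injOn dist_nonneg dist_nonneg h3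

/-! ### The exceptional vectors form a null set -/

/-- The unit vectors on the circle of radius `r` around `p` whose Clairaut quantity at `q` agrees
with that of the reflected vector at `q'`. -/
def clairautCoincidence (p : ℍ) (r : ℝ) (q q' : ℍ) : Set UnitTangent :=
  {v | dist v.base p = r ∧ clairaut v q = clairaut (radialReflection p v) q'}

lemma continuous_gradCosh (q : ℍ) : Continuous (gradCosh q) := by
  unfold gradCosh
  have h1 := continuous_coe
  have h2 := continuous_im
  refine Continuous.div (by fun_prop) (by fun_prop) fun z => ?_
  have := z.im_pos.ne'
  have := q.im_pos.ne'
  exact_mod_cast (by positivity : 2 * z.im ^ 2 * q.im ≠ 0)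

lemma clairautCoincidence_eq {p : ℍ} {r : ℝ} (hr : 0 < r) (q q' : ℍ) :
    clairautCoincidence p r q q' = {v | dist v.base p = r ∧
      Real.cosh (dist v.base q) ^ 2 - Real.cosh (dist v.base q') ^ 2 =
        (conj v.dir ^ 2 * clairautCoeff p q q' v.base).re} := by
  ext v
  refine and_congr_right fun h => ?_
  exact clairaut_eq_clairaut_radialReflection_iff (dist_pos.1 (h ▸ hr)) q q'

lemma measurable_base_dir : Measurable fun v : UnitTangent => (v.base, v.dir) :=
  comap_measurable _

lemma measurableSet_clairautCoincidence {p : ℍ} {r : ℝ} (hr : 0 < r) (q q' : ℍ) :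
    MeasurableSet (clairautCoincidence p r q q') := by
  rw [clairautCoincidence_eq hr]
  have hb : Measurable fun v : UnitTangent => v.base := measurable_base_dir.fst
  have hd : Measurable fun v : UnitTangent => v.dir := measurable_base_dir.snd
  have hg : ∀ q : ℍ, Measurable fun v : UnitTangent => gradCosh q v.base := fun q =>
    (continuous_gradCosh q).measurable.comp hb
  have hdist : ∀ q : ℍ, Measurable fun v : UnitTangent => dist v.base q := fun q =>
    (continuous_id.dist continuous_const).measurable.comp hb
  have hconj : Measurable (fun z : ℂ => conj z) := Complex.continuous_conj.measurable
  refine MeasurableSet.inter (measurableSet_eq_fun (hdist p) measurable_const)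
    (measurableSet_eq_fun ?_ ?_)
  · exact ((Real.measurable_cosh.comp (hdist q)).pow_const 2).sub
      ((Real.measurable_cosh.comp (hdist q')).pow_const 2)
  · refine Complex.measurable_re.comp (((hconj.comp hd).pow_const 2).mul ?_)
    exact ((hg q).pow_const 2).sub
      ((((hg p).div (hconj.comp (hg p))).mul (hconj.comp (hg q'))).pow_const 2)

lemma planeLiouville_clairautCoincidence (K : Set ℍ) {p q q' : ℍ} (h : q ≠ p ∨ q' ≠ p) {r : ℝ}
    (hr : 0 < r) : planeLiouville K (clairautCoincidence p r q q') = 0 := by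
  have hm := measurableSet_clairautCoincidence (p := p) hr q q'
  refine withDensity_absolutelyContinuous _ _ ?_
  rw [Measure.map_apply UnitTangent.measurable_ofAngle hm,
    Measure.measure_prod_null (UnitTangent.measurable_ofAngle hm)]
  have hE := finite_exceptional_points h hr
  have hnull : (Measure.hausdorffMeasure 1 : Measure ℍ).restrict K
      {z : ℍ | dist z p = r ∧ Real.cosh (dist z q) ^ 2 - Real.cosh (dist z q') ^ 2 = 0 ∧
        clairautCoeff p q q' z = 0} = 0 := by
    have := Measure.nullSingletonClass_hausdorff ℍ one_pos
    exact Measure.absolutelyContinuous_of_le Measure.restrict_le_self (hE.measure_zero _)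
  filter_upwards [measure_eq_zero_iff_ae_notMem.1 hnull] with z hz
  rw [Pi.zero_apply, Measure.restrict_apply
    (measurable_prodMk_left (UnitTangent.measurable_ofAngle hm))]
  by_cases hzp : dist z p = r
  · have hy : ((z.im : ℝ) : ℂ) ≠ 0 := by exact_mod_cast z.im_pos.ne'
    refine (Set.Finite.subset (finite_angles (z.im ^ 2 * clairautCoeff p q q' z)
      (Real.cosh (dist z q) ^ 2 - Real.cosh (dist z q') ^ 2) ?_) ?_).measure_zero _
    · by_contra! h0
      exact hz ⟨hzp, h0.2, (mul_eq_zero.1 h0.1).resolve_left (pow_ne_zero 2 hy)⟩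
    · rintro θ ⟨hθ, hI⟩
      refine ⟨hI, ?_⟩
      rw [clairautCoincidence_eq hr] at hθ
      refine hθ.2.trans (congrArg Complex.re ?_)
      simp only [UnitTangent.ofAngle, map_mul, Complex.conj_ofReal]
      ring
  · convert measure_empty (μ := (volume : Measure ℝ))
    refine Set.eq_empty_of_forall_notMem fun θ hθ => hzp ?_
    exact hθ.1.1

/-! ### Lifts to the hyperbolic plane -/

lemma exists_midpoint (z w : ℍ) : ∃ m : ℍ, dist m z = dist z w / 2 ∧ dist m w = dist z w / 2 := by
  by_cases h : z = w
  · exact ⟨z, by simp [h], by simp [h]⟩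
  have hg := norm_pos_iff.2 (gradCosh_ne_zero h)
  have hy := z.im_pos
  -- The unit vector at `z` pointing towards `w`, opposite to the gradient of the distance.
  let v : UnitTangent := ⟨z, (-(z.im / ‖gradCosh w z‖) : ℝ) * gradCosh w z, by
    rw [norm_mul, Complex.norm_real, norm_neg, Real.norm_of_nonneg (by positivity)]
    field_simp⟩
  have hv : radialSpeed v w = -Real.sinh (dist z w) := by
    have h1 : radialSpeed v w = -(z.im * ‖gradCosh w z‖) := by
      simp only [radialSpeed, v, map_mul, Complex.conj_ofReal]
      rw [mul_assoc, mul_comm (conj _), Complex.mul_conj, Complex.normSq_eq_norm_sq,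
        ← Complex.ofReal_mul, Complex.ofReal_re]
      field_simp
    rw [h1, neg_inj]
    refine (sq_eq_sq₀ (by positivity) (Real.sinh_nonneg_iff.2 dist_nonneg)).1 ?_
    rw [mul_pow, ← Complex.normSq_eq_norm_sq, normSq_gradCosh, Real.cosh_sq]
    ring
  refine ⟨(planeFlow (dist z w / 2) v).base, ?_, ?_⟩
  · have := dist_planeFlow_self (dist z w / 2) v
    rwa [abs_of_nonneg (by positivity)] at this
  · have h2 := cosh_dist_planeFlow (dist z w / 2) v w
    rw [hv] at h2
    have h3 : Real.cosh (dist z w - dist z w / 2) = Real.cosh (dist z w / 2) := by ring_nf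
    rw [Real.cosh_sub] at h3
    refine Real.cosh_strictMonoOn.injOn dist_nonneg (by positivity : 0 ≤ dist z w / 2) ?_
    rw [← h3, h2]
    ring

variable {Γ : Subgroup PGL(2, ℝ)}

lemma proj_eq_proj_iff {z w : ℍ} : proj Γ z = proj Γ w ↔ ∃ γ ∈ Γ, γ • w = z := by
  rw [proj, proj, Quotient.eq, MulAction.orbitRel_apply, MulAction.mem_orbit_iff]
  simp [Subgroup.smul_def]

lemma proj_smul {γ : PGL(2, ℝ)} (hγ : γ ∈ Γ) (z : ℍ) : proj Γ (γ • z) = proj Γ z :=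
  proj_eq_proj_iff.2 ⟨γ, hγ, rfl⟩

lemma projUnit_eq_projUnit_iff {v w : UnitTangent} :
    projUnit Γ v = projUnit Γ w ↔ ∃ γ ∈ Γ, γ • w = v := by
  rw [projUnit, projUnit, Quotient.eq, MulAction.orbitRel_apply, MulAction.mem_orbit_iff]
  simp [Subgroup.smul_def]

variable (Γ) in
/-- The lifts of a point of the surface. -/
def fiber (p : Surface Γ) : Set ℍ := proj Γ ⁻¹' {p}

lemma smul_mem_fiber {p : Surface Γ} {γ : PGL(2, ℝ)} (hγ : γ ∈ Γ) {q : ℍ} (hq : q ∈ fiber Γ p) :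
    γ • q ∈ fiber Γ p :=
  (proj_smul hγ q).trans hq

/-- If `q` and `γ • q` were closer than `2 * ρ`, their midpoint `m` and `γ⁻¹ • m` would both lie in
the ball around `q`. Injectivity then makes `m` a fixed point, against freeness. -/
lemma separated_fiber (hfree : ∀ γ ∈ Γ, ∀ z : ℍ, γ • z = z → γ = 1) {p : Surface Γ} {ρ : ℝ}
    (hρ : ∀ z : ℍ, proj Γ z = p → Set.InjOn (proj Γ) (Metric.ball z ρ)) :
    Separated (fiber Γ p) ρ := by
  intro q hq q' hq' hne
  by_contra! hlt
  obtain ⟨γ, hγ, rfl⟩ := proj_eq_proj_iff.1 (hq'.trans hq.symm : proj Γ q' = proj Γ q)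
  obtain ⟨m, hm1, hm2⟩ := exists_midpoint q (γ • q)
  have h1 : m ∈ Metric.ball q ρ := by
    rw [Metric.mem_ball, hm1]; linarith
  have h2 : γ⁻¹ • m ∈ Metric.ball q ρ := by
    rw [Metric.mem_ball, ← dist_PGL_smul γ, smul_inv_smul, hm2]; linarith
  have h3 := hρ q hq h2 h1 (proj_smul (Γ.inv_mem hγ) m)
  have h4 := hfree _ (Γ.inv_mem hγ) m h3
  rw [inv_eq_one.1 h4, one_smul] at hne
  exact hne rfl

lemma exists_pos_injOn_of_lt_injectivityRadius {p : Surface Γ} {r : ℝ} (hr : 0 < r)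
    (h : ENNReal.ofReal r < injectivityRadius Γ p) :
    ∃ ρ : ℝ, r < ρ ∧ ∀ z : ℍ, proj Γ z = p → Set.InjOn (proj Γ) (Metric.ball z ρ) := by
  simp only [injectivityRadius, lt_iSup_iff] at h
  obtain ⟨ρ, hρ, hlt⟩ := h
  refine ⟨ρ, ?_, hρ⟩
  rwa [ENNReal.ofReal, ENNReal.coe_lt_coe, Real.toNNReal_lt_iff_lt_coe hr.le] at hlt

lemma surfaceDist_proj (w : ℍ) (p : Surface Γ) :
    surfaceDist Γ (proj Γ w) p = Metric.infDist w (fiber Γ p) := by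
  rw [surfaceDist, Metric.infDist_eq_iInf, iInf]
  congr 1
  ext d
  constructor
  · rintro ⟨z, q, hz, hq, rfl⟩
    obtain ⟨γ, hγ, rfl⟩ := proj_eq_proj_iff.1 hz.symm
    exact ⟨⟨γ • q, smul_mem_fiber hγ hq⟩, dist_PGL_smul γ z q⟩
  · rintro ⟨⟨q, hq⟩, rfl⟩
    exact ⟨w, q, rfl, hq, rfl⟩

lemma lift_distanceCircle {p : Surface Γ} {r ρ : ℝ} (hO : Separated (fiber Γ p) ρ) (hr : 0 < r)
    (hrρ : r < ρ) : lift Γ (distanceCircle Γ p r) = circleUnion (fiber Γ p) r := by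
  ext w
  rw [hO.mem_circleUnion_iff_infDist hr hrρ, ← surfaceDist_proj]
  rfl

lemma flow_zero (x : UnitBundle Γ) : flow Γ 0 x = x := by
  induction x using Quotient.inductionOn with
  | h v => exact congrArg (projUnit Γ) (planeFlow_zero v)

lemma flow_flow (s t : ℝ) (x : UnitBundle Γ) : flow Γ s (flow Γ t x) = flow Γ (s + t) x := by
  induction x using Quotient.inductionOn with
  | h v => exact congrArg (projUnit Γ) (planeFlow_planeFlow s t v)

lemma flow_projUnit_mem_unitBundleOver_iff {H : Set (Surface Γ)} {t : ℝ} {v : UnitTangent} :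
    flow Γ t (projUnit Γ v) ∈ unitBundleOver Γ H ↔ (planeFlow t v).base ∈ lift Γ H := Iff.rfl

section

variable {p : Surface Γ} {r ρ : ℝ}

/-- A vector with microlocal reflection symmetry has a lift whose Clairaut quantity at some lift of
the centre agrees with that of the reflected vector at some lift of the centre, and these lifts of
the centre are not both the centre of the circle which carries the vector. -/
lemma symmetricSet_distanceCircle_subset (hO : Separated (fiber Γ p) ρ) (hr : 0 < r) (hrρ : r < ρ)
    {o : ℍ} (ho : o ∈ fiber Γ p) {x : UnitBundle Γ}
    (hx : x ∈ symmetricSet Γ (distanceCircle Γ p r)) :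
    ∃ q ∈ fiber Γ p, ∃ q' ∈ fiber Γ p, (q ≠ o ∨ q' ≠ o) ∧
      x ∈ projUnit Γ '' clairautCoincidence o r q q' := by
  have hlift := lift_distanceCircle hO hr hrρ
  obtain ⟨hxS, j, hj, t, ht, hsymm⟩ := hx
  obtain ⟨v, hv, rfl⟩ : ∃ v : UnitTangent, dist v.base o = r ∧ projUnit Γ v = x := by
    obtain ⟨v, rfl⟩ : ∃ v, projUnit Γ v = x := Quotient.exists_rep x
    obtain ⟨q, hq, hvq⟩ : v.base ∈ circleUnion (fiber Γ p) r := by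
      rw [← hlift]; exact hxS
    -- The group is transitive on the lifts of `p`, so the lifted vector can be moved to the circle
    -- around the fixed centre `o`.
    obtain ⟨γ, hγ, rfl⟩ := proj_eq_proj_iff.1 (ho.trans hq.symm : proj Γ o = proj Γ q)
    exact ⟨γ • v, by rw [PGL_smul_base, dist_PGL_smul, hvq],
      projUnit_eq_projUnit_iff.2 ⟨γ, hγ, rfl⟩⟩
  have hvo : v.base ≠ o := dist_pos.1 (hv ▸ hr)
  obtain ⟨ht0, htS⟩ := returnTime_mem flow_zero flow_flow (fun x => by
      obtain ⟨w, rfl⟩ : ∃ w, projUnit Γ w = x := Quotient.exists_rep x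
      simp only [flow_projUnit_mem_unitBundleOver_iff, hlift]
      exact (hO.isClosed_circleUnion hr hrρ).preimage (continuous_planeFlow_base w)) hxS (by
      simp only [flow_projUnit_mem_unitBundleOver_iff, hlift]
      exact hO.exists_pos_forall_notMem hrρ v ⟨o, ho, hv⟩) hj ht
  rw [flow_projUnit_mem_unitBundleOver_iff, hlift] at htS
  obtain ⟨q, hq, hvq⟩ := htS
  have hvq0 : (planeFlow t v).base ≠ q := dist_pos.1 (hvq ▸ hr)
  have e1 : reflection Γ (distanceCircle Γ p r) (projUnit Γ v) =
      projUnit Γ (radialReflection o v) := by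
    rw [← hO.planeReflection_circleUnion hr hrρ ho hv, ← hlift]; rfl
  have e2 : reflection Γ (distanceCircle Γ p r) (flow Γ t (projUnit Γ v)) =
      projUnit Γ (radialReflection q (planeFlow t v)) := by
    rw [← hO.planeReflection_circleUnion hr hrρ hq hvq, ← hlift]; rfl
  rw [e1, e2] at hsymm
  obtain ⟨γ, hγ, hγv⟩ := projUnit_eq_projUnit_iff.1
    (hsymm.symm : projUnit Γ (planeFlow t (radialReflection o v)) = projUnit Γ _)
  refine ⟨q, hq, γ • q, smul_mem_fiber hγ hq, ?_, v, ⟨hv, ?_⟩, rfl⟩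
  -- If both centres are `o`, then `cosh r * cosh t ± radialSpeed v o * sinh t = cosh r` for both
  -- signs; adding gives `cosh t = 1`, although `t ≠ 0`.
  · by_contra! h
    obtain ⟨rfl, hγq⟩ := h
    have h1 := cosh_dist_planeFlow t v q
    have h2 := cosh_dist_planeFlow t (radialReflection q v) q
    rw [← hγv, PGL_smul_base, ← hγq, dist_PGL_smul, hγq, radialReflection_base,
      radialReflection_base, radialSpeed_radialReflection hvo, hvq, hv] at h2
    rw [hvq, hv] at h1
    have h3 : Real.cosh r * Real.cosh t = Real.cosh r * 1 := by linarith
    exact (Real.one_lt_cosh.2 ht0).ne' (mul_left_cancel₀ (Real.cosh_pos r).ne' h3)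
  · rw [← clairaut_planeFlow t (radialReflection o v), ← hγv, clairaut_smul,
      clairaut_radialReflection hvq0, clairaut_planeFlow]

end

end HypSurface

end

/-! ### Conclusion: a countable union of null sets -/

theorem mainTheorem11 (Γ : Subgroup PGL(2, ℝ)) (hΓ : HypSurface.IsSurfaceGroup Γ)
    (p : HypSurface.Surface Γ) (r : ℝ) (hr : 0 < r)
    (hinj : ENNReal.ofReal r < HypSurface.injectivityRadius Γ p) :
    ¬ HypSurface.HasPositiveMeasureReflectionSymmetry Γ (HypSurface.distanceCircle Γ p r) := by
  open HypSurface in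
  obtain ⟨ρ, hrρ, hρ⟩ := exists_pos_injOn_of_lt_injectivityRadius hr hinj
  have hO := separated_fiber hΓ.free hρ
  have hcount := hO.countable (hr.trans hrρ)
  obtain ⟨o, ho⟩ : ∃ o, proj Γ o = p := Quotient.exists_rep p
  let I : Set (UpperHalfPlane × UpperHalfPlane) :=
    (fiber Γ p ×ˢ fiber Γ p) ∩ {a | a.1 ≠ o ∨ a.2 ≠ o}
  have hI : I.Countable := (hcount.prod hcount).mono Set.inter_subset_left
  have hle : liouville Γ (distanceCircle Γ p r) (symmetricSet Γ (distanceCircle Γ p r)) ≤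
      planeLiouville (lift Γ (distanceCircle Γ p r))
        (⋃ a ∈ I, clairautCoincidence o r a.1 a.2) := by
    -- `liouville` is an infimum over measurable covers upstairs, so one null cover suffices and the
    -- symmetric set itself need not be shown measurable.
    refine iInf_le_of_le _ (iInf_le_of_le (MeasurableSet.biUnion hI fun a _ =>
      measurableSet_clairautCoincidence hr a.1 a.2) (iInf_le _ ?_))
    intro x hx
    obtain ⟨q, hq, q', hq', hne, v, hv, rfl⟩ := symmetricSet_distanceCircle_subset hO hr hrρ ho hx
    exact ⟨v, Set.mem_biUnion (x := (q, q')) ⟨⟨hq, hq'⟩, hne⟩ hv, rfl⟩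
  have hzero : planeLiouville (lift Γ (distanceCircle Γ p r))
      (⋃ a ∈ I, clairautCoincidence o r a.1 a.2) = 0 :=
    (MeasureTheory.measure_biUnion_null_iff hI).2 fun a ha =>
      planeLiouville_clairautCoincidence _ ha.2 hr
  exact not_lt.2 (hle.trans hzero.le)
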